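/- Let $\Bbbk$ be a field (for instance $\Bbbk=\mathbb C$), let $q\in\Bbbk$ be non-zero and let $q^{1/2}\in\Bbbk$ be a square root of $q$. **Notions.** Let $H$ be a bialgebra over $\Bbbk$ with multiplication $m$, unit map $u$, counit $\varepsilon$, flip $\tau$ and convolution product $*$. For linear $f:H\otimes H\to\Bbbk$ put $f_{12}=f\otimes\varepsilon$, $f_{23}=\varepsilon\otimes f$, $f_{13}=(\varepsilon\otimes f)(\tau\otimes\mathrm{Id})$ and $f^{\mathrm{op}}=f\tau$. A *universal $\mathcal R$-form* is a convolution invertible linear map $\mathcal R:H\otimes H\to\Bbbk$ with $(u\mathcal R)*m=m\tau*(u\mathcal R)$, $\mathcal R(\mathrm{Id}\otimes m)=\mathcal R_{13}*\mathcal R_{12}$ and $\mathcal R(m\otimes\mathrm{Id})=\mathcal R_{13}*\mathcal R_{23}$. Given such an $\mathcal R$, an *infinitesimal $\mathcal R$-form* is a linear map $\chi:H\otimes H\to\Bbbk$ with $$(u\chi)*m=m*(u\chi),\quad \chi(\mathrm{Id}\otimes m)=\chi_{12}+\mathcal R_{12}^{-1}*\chi_{13}*\mathcal R_{12},\quad \chi(m\otimes\mathrm{Id})=\chi_{23}+\mathcal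 R_{23}^{-1}*\chi_{13}*\mathcal R_{23}.$$ The triple $(H,\mathcal R,\chi)$ is then called *pre-Cartier*, and *Cartier* if moreover $\mathcal R*\chi=\chi^{\mathrm{op}}*\mathcal R$. A derivation $D:A\to\Bbbk$ on an algebra $A$ with character $\varepsilon$ is a linear map with $D(xy)=D(x)\varepsilon(y)+\varepsilon(x)D(y)$. **The bialgebras.** $\mathrm M_q(2)$ is the algebra generated by $\alpha,\beta,\gamma,\delta$ with relations $\beta\alpha=q\alpha\beta$, $\gamma\alpha=q\alpha\gamma$, $\delta\beta=q\beta\delta$, $\delta\gamma=q\gamma\delta$, $\gamma\beta=\beta\gamma$, $\alpha\delta-\delta\alpha=(q^{-1}-q)\beta\gamma$, with matrix comultiplication and with counit sending $\begin{pmatrix}\alpha&\beta\\\gamma&\delta\end{pmatrix}$ to the identity matrix. It is graded by word length $|\cdot|$, and $\partial_q=(\partial\otimes\varepsilon)\rho:\mathrm M_q(2)\to\Bbbk$, where $\rho:\mathrm M_q(2)\to\Bbbk[X]\otimes\mathrm M_q(2)$ is the algebra map $\xi\mapsto X^{|\xi|}\otimes\xi$ ($\xi$ homogeneous) and $\partial:\Bbbk[X]\to\Bbbk$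 is linear with $\partial(X^n)=n$. With $\det_q=\alpha\delta-q^{-1}\beta\gamma$, put $\mathrm{GL}_q(2)=\mathrm M_q(2)[\theta]/(\theta\det_q-1)$, where $\theta$ is a central variable; it is a bialgebra with structure extending that of $\mathrm M_q(2)$ and $\theta$ grouplike. **Statement.** 1. There is a unique universal $\mathcal R$-form $\mathcal R$ on $\mathrm M_q(2)$ with $\mathcal R(\alpha\otimes\alpha)=\mathcal R(\delta\otimes\delta)=q^{-1/2}q$, $\mathcal R(\alpha\otimes\delta)=\mathcal R(\delta\otimes\alpha)=q^{-1/2}$, $\mathcal R(\beta\otimes\gamma)=q^{-1/2}(q-q^{-1})$, and value $0$ on the other eleven pairs of generators. The form $\chi=\partial_q\otimes\partial_q$ is a non-zero infinitesimal $\mathcal R$-form on $\mathrm M_q(2)$, the triple $(\mathrm M_q(2),\mathcal R,\chi)$ is Cartier, and $\chi(\xi\otimes\eta)=|\xi|\,|\eta|\,\varepsilon(\xi\eta)$ for all homogeneous $\xi,\eta$. 2. There is a unique universal $\mathcal R$-form on $\mathrm{GL}_q(2)$, again denoted $\mathcal R$, whose pullback along $\mathrm M_q(2)\to\mathrm{GL}_q(2)$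 is the form of part 1. There is a unique derivation $\hat\partial_q:\mathrm M_q(2)[\theta]\to\Bbbk$ (with respect to the counit extended by $\theta\mapsto1$) that restricts to $\partial_q$ on $\mathrm M_q(2)$ and maps $\theta$ to $-2$; it descends to a derivation $\hat\partial_q:\mathrm{GL}_q(2)\to\Bbbk$. The form $\chi=\hat\partial_q\otimes\hat\partial_q$ is a non-zero infinitesimal $\mathcal R$-form on $\mathrm{GL}_q(2)$, and $(\mathrm{GL}_q(2),\mathcal R,\chi)$ is Cartier. -/

import Mathlib

open scoped TensorProduct
open Coalgebra WithConv

noncomputable section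

section Coquasitriangular

variable {𝕜 H : Type*} [Field 𝕜] [Ring H] [Bialgebra 𝕜 H]

/-- Convolution invertible linear maps `H ⊗ H → 𝕜`. -/
abbrev ConvUnits (𝕜 H : Type*) [Field 𝕜] [Ring H] [Bialgebra 𝕜 H] :=
  (WithConv (H ⊗[𝕜] H →ₗ[𝕜] 𝕜))ˣ

/-- The form `f ⊗ g : H ⊗ H → 𝕜`, `a ⊗ b ↦ f a * g b`. -/
def tensorForm (f g : H →ₗ[𝕜] 𝕜) : H ⊗[𝕜] H →ₗ[𝕜] 𝕜 :=
  (TensorProduct.lid 𝕜 𝕜).toLinearMap ∘ₗ TensorProduct.map f g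

/-- `f₁₂ = f ⊗ ε`, as an element of the convolution algebra on `H ⊗ H ⊗ H`. -/
def leg12 (f : H ⊗[𝕜] H →ₗ[𝕜] 𝕜) : WithConv (H ⊗[𝕜] (H ⊗[𝕜] H) →ₗ[𝕜] 𝕜) :=
  toConv ((TensorProduct.lid 𝕜 𝕜).toLinearMap ∘ₗ
    TensorProduct.map f (counit (R := 𝕜) (A := H)) ∘ₗ
      (TensorProduct.assoc 𝕜 H H H).symm.toLinearMap)

/-- `f₂₃ = ε ⊗ f`. -/
def leg23 (f : H ⊗[𝕜] H →ₗ[𝕜] 𝕜) : WithConv (H ⊗[𝕜] (H ⊗[𝕜] H) →ₗ[𝕜] 𝕜) :=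
  toConv ((TensorProduct.lid 𝕜 𝕜).toLinearMap ∘ₗ
    TensorProduct.map (counit (R := 𝕜) (A := H)) f)

/-- `f₁₃ = (ε ⊗ f) (τ ⊗ Id)`. -/
def leg13 (f : H ⊗[𝕜] H →ₗ[𝕜] 𝕜) : WithConv (H ⊗[𝕜] (H ⊗[𝕜] H) →ₗ[𝕜] 𝕜) :=
  toConv ((leg23 f).ofConv ∘ₗ (TensorProduct.assoc 𝕜 H H H).toLinearMap ∘ₗ
    TensorProduct.map (TensorProduct.comm 𝕜 H H).toLinearMap LinearMap.id ∘ₗ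
      (TensorProduct.assoc 𝕜 H H H).symm.toLinearMap)

/-- `u_H f`, i.e. `f` followed by the unit map `𝕜 → H`. -/
def unitComp (f : H ⊗[𝕜] H →ₗ[𝕜] 𝕜) : WithConv (H ⊗[𝕜] H →ₗ[𝕜] H) :=
  toConv (Algebra.linearMap 𝕜 H ∘ₗ f)

/-- `f (Id ⊗ m)`, i.e. `a ⊗ b ⊗ c ↦ f (a ⊗ b c)`. -/
def formMulRight (f : H ⊗[𝕜] H →ₗ[𝕜] 𝕜) : WithConv (H ⊗[𝕜] (H ⊗[𝕜] H) →ₗ[𝕜] 𝕜) :=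
  toConv (f ∘ₗ TensorProduct.map LinearMap.id (LinearMap.mul' 𝕜 H))

/-- `f (m ⊗ Id)`, i.e. `a ⊗ b ⊗ c ↦ f (a b ⊗ c)`. -/
def formMulLeft (f : H ⊗[𝕜] H →ₗ[𝕜] 𝕜) : WithConv (H ⊗[𝕜] (H ⊗[𝕜] H) →ₗ[𝕜] 𝕜) :=
  toConv (f ∘ₗ TensorProduct.map (LinearMap.mul' 𝕜 H) LinearMap.id ∘ₗ
    (TensorProduct.assoc 𝕜 H H H).symm.toLinearMap)

/-- `R` is a universal R-form: `R * m = mᵒᵖ * R`, `R (Id ⊗ m) = R₁₃ * R₁₂` and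
`R (m ⊗ Id) = R₁₃ * R₂₃`, all products being convolution products. -/
structure IsCoquasitriangular (R : ConvUnits 𝕜 H) : Prop where
  mul_comm : unitComp R.val.ofConv * toConv (LinearMap.mul' 𝕜 H) =
    toConv (LinearMap.mul' 𝕜 H ∘ₗ (TensorProduct.comm 𝕜 H H).toLinearMap) *
      unitComp R.val.ofConv
  mul_right : formMulRight R.val.ofConv = leg13 R.val.ofConv * leg12 R.val.ofConv
  mul_left : formMulLeft R.val.ofConv = leg13 R.val.ofConv * leg23 R.val.ofConv

/-- `χ` is an infinitesimal R-form: `(u χ) * m = m * (u χ)`,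
`χ (Id ⊗ m) = χ₁₂ + R₁₂⁻¹ * χ₁₃ * R₁₂` and `χ (m ⊗ Id) = χ₂₃ + R₂₃⁻¹ * χ₁₃ * R₂₃`. -/
structure IsInfinitesimalRForm (R : ConvUnits 𝕜 H) (χ : H ⊗[𝕜] H →ₗ[𝕜] 𝕜) : Prop where
  mul_comm : unitComp χ * toConv (LinearMap.mul' 𝕜 H) =
    toConv (LinearMap.mul' 𝕜 H) * unitComp χ
  mul_right : formMulRight χ = leg12 χ + leg12 R⁻¹.val.ofConv * leg13 χ * leg12 R.val.ofConv
  mul_left : formMulLeft χ = leg23 χ + leg23 R⁻¹.val.ofConv * leg13 χ * leg23 R.val.ofConv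

/-- `(H, R, χ)` is a pre-Cartier coquasitriangular bialgebra. -/
structure IsPreCartier (R : ConvUnits 𝕜 H) (χ : H ⊗[𝕜] H →ₗ[𝕜] 𝕜) : Prop where
  coquasitriangular : IsCoquasitriangular R
  infinitesimalRForm : IsInfinitesimalRForm R χ

/-- `(H, R, χ)` is Cartier: it is pre-Cartier and `R * χ = χᵒᵖ * R`. -/
structure IsCartier (R : ConvUnits 𝕜 H) (χ : H ⊗[𝕜] H →ₗ[𝕜] 𝕜) : Prop
    extends IsPreCartier R χ where
  cartier : R.val * toConv χ =
    toConv (χ ∘ₗ (TensorProduct.comm 𝕜 H H).toLinearMap) * R.val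

end Coquasitriangular

/-- `D : A → 𝕜` is a derivation, where `𝕜` is an `A`-bimodule through the character `e`. -/
def IsPointDerivation {𝕜 A : Type*} [Field 𝕜] [Ring A] [Algebra 𝕜 A]
    (e : A →ₐ[𝕜] 𝕜) (D : A →ₗ[𝕜] 𝕜) : Prop :=
  ∀ x y : A, D (x * y) = D x * e y + e x * D y

section Mq

variable {𝕜 : Type*} [Field 𝕜] (q : 𝕜ˣ)

/-- The Manin relations on the free algebra on the entries `(i, j)` of a 2 × 2 matrix. -/
inductive ManinRel : FreeAlgebra 𝕜 (Fin 2 × Fin 2) → FreeAlgebra 𝕜 (Fin 2 × Fin 2) → Prop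
  | ba : ManinRel (.ι 𝕜 (0, 1) * .ι 𝕜 (0, 0)) ((q : 𝕜) • (.ι 𝕜 (0, 0) * .ι 𝕜 (0, 1)))
  | ca : ManinRel (.ι 𝕜 (1, 0) * .ι 𝕜 (0, 0)) ((q : 𝕜) • (.ι 𝕜 (0, 0) * .ι 𝕜 (1, 0)))
  | db : ManinRel (.ι 𝕜 (1, 1) * .ι 𝕜 (0, 1)) ((q : 𝕜) • (.ι 𝕜 (0, 1) * .ι 𝕜 (1, 1)))
  | dc : ManinRel (.ι 𝕜 (1, 1) * .ι 𝕜 (1, 0)) ((q : 𝕜) • (.ι 𝕜 (1, 0) * .ι 𝕜 (1, 1)))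
  | cb : ManinRel (.ι 𝕜 (1, 0) * .ι 𝕜 (0, 1)) (.ι 𝕜 (0, 1) * .ι 𝕜 (1, 0))
  | ad : ManinRel (.ι 𝕜 (0, 0) * .ι 𝕜 (1, 1) - .ι 𝕜 (1, 1) * .ι 𝕜 (0, 0))
      (((q : 𝕜)⁻¹ - q) • (.ι 𝕜 (0, 1) * .ι 𝕜 (1, 0)))

/-- The quantum matrix algebra `M_q(2)`. -/
def Mq : Type _ := RingQuot (ManinRel q)

instance : Ring (Mq q) := inferInstanceAs (Ring (RingQuot (ManinRel q)))
instance : Algebra 𝕜 (Mq q) := inferInstanceAs (Algebra 𝕜 (RingQuot (ManinRel q)))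

namespace Mq

def mk : FreeAlgebra 𝕜 (Fin 2 × Fin 2) →ₐ[𝕜] Mq q := RingQuot.mkAlgHom 𝕜 (ManinRel q)

/-- The generators of `M_q(2)`, arranged as the matrix with rows `α, β` and `γ, δ`. -/
def T (i j : Fin 2) : Mq q := mk q (.ι 𝕜 (i, j))

abbrev α : Mq q := T q 0 0
abbrev β : Mq q := T q 0 1
abbrev γ : Mq q := T q 1 0
abbrev δ : Mq q := T q 1 1

theorem mk_rel {x y : FreeAlgebra 𝕜 (Fin 2 × Fin 2)} (h : ManinRel q x y) :
    mk q x = mk q y :=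
  RingQuot.mkAlgHom_rel 𝕜 h

theorem ba : β q * α q = (q : 𝕜) • (α q * β q) := by
  simpa [T] using mk_rel q .ba

theorem ca : γ q * α q = (q : 𝕜) • (α q * γ q) := by
  simpa [T] using mk_rel q .ca

theorem db : δ q * β q = (q : 𝕜) • (β q * δ q) := by
  simpa [T] using mk_rel q .db

theorem dc : δ q * γ q = (q : 𝕜) • (γ q * δ q) := by
  simpa [T] using mk_rel q .dc

theorem cb : γ q * β q = β q * γ q := by
  simpa [T] using mk_rel q .cb

theorem ad : α q * δ q - δ q * α q = ((q : 𝕜)⁻¹ - q) • (β q * γ q) := by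
  simpa [T] using mk_rel q .ad

theorem da : δ q * α q = α q * δ q - ((q : 𝕜)⁻¹ - q) • (β q * γ q) := by
  rw [← ad]; abel

variable {B : Type*} [Ring B] [Algebra 𝕜 B]

/-- The algebra map out of `M_q(2)` given by four elements subject to the Manin relations. -/
def lift (t : Fin 2 → Fin 2 → B)
    (h : ∀ x y, ManinRel q x y →
      FreeAlgebra.lift 𝕜 (fun p : Fin 2 × Fin 2 ↦ t p.1 p.2) x =
        FreeAlgebra.lift 𝕜 (fun p : Fin 2 × Fin 2 ↦ t p.1 p.2) y) : Mq q →ₐ[𝕜] B :=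
  RingQuot.liftAlgHom 𝕜 ⟨FreeAlgebra.lift 𝕜 fun p : Fin 2 × Fin 2 ↦ t p.1 p.2, h⟩

theorem lift_T (t : Fin 2 → Fin 2 → B) (h) (i j : Fin 2) : lift q t h (T q i j) = t i j := by
  unfold lift T mk
  refine (RingQuot.liftAlgHom_mkAlgHom_apply _ _ _ _).trans ?_
  simp

theorem algHom_ext {f g : Mq q →ₐ[𝕜] B} (h : ∀ i j, f (T q i j) = g (T q i j)) : f = g := by
  refine RingQuot.ringQuot_ext' 𝕜 f g (FreeAlgebra.hom_ext ?_)
  funext p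
  exact h p.1 p.2

/-- Matrix comultiplication. -/
def comulHom : Mq q →ₐ[𝕜] Mq q ⊗[𝕜] Mq q :=
  lift q (fun i j ↦ ∑ k, T q i k ⊗ₜ[𝕜] T q k j) (by
    have hq : (q : 𝕜) ≠ 0 := q.ne_zero
    intro x y h
    cases h <;>
    simp only [map_mul, map_smul, map_sub, FreeAlgebra.lift_ι_apply, Fin.sum_univ_two, add_mul,
      mul_add, Algebra.TensorProduct.tmul_mul_tmul, ba, ca, db, dc, cb, da,
      ← TensorProduct.smul_tmul', TensorProduct.tmul_smul, TensorProduct.sub_tmul,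
      TensorProduct.tmul_sub, smul_add, smul_sub, smul_smul] <;>
    match_scalars <;> (try field_simp) <;> ring)

/-- The counit, sending the matrix of generators to the identity matrix. -/
def counitHom : Mq q →ₐ[𝕜] 𝕜 :=
  lift q (fun i j ↦ if i = j then 1 else 0) (by
    intro x y h
    cases h <;> simp)

instance : Bialgebra 𝕜 (Mq q) :=
  Bialgebra.ofAlgHom (comulHom q) (counitHom q)
    (algHom_ext q fun i j ↦ by
      simp [comulHom, lift_T, TensorProduct.tmul_add, TensorProduct.add_tmul]
      abel)
    (algHom_ext q fun i j ↦ by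
      fin_cases i <;> fin_cases j <;> simp [comulHom, counitHom, lift_T])
    (algHom_ext q fun i j ↦ by
      fin_cases i <;> fin_cases j <;> simp [comulHom, counitHom, lift_T])

theorem comul_T (i j : Fin 2) :
    comul (R := 𝕜) (T q i j) = ∑ k, T q i k ⊗ₜ[𝕜] T q k j :=
  lift_T q _ _ i j

theorem counit_T (i j : Fin 2) : counit (R := 𝕜) (T q i j) = if i = j then 1 else 0 :=
  lift_T q _ _ i j

/-- The coaction of `𝕜[X]` (with `X` grouplike) that encodes the grading by length:
the algebra map `ξ ↦ X ^ |ξ| ⊗ ξ`. -/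
def degCoaction : Mq q →ₐ[𝕜] Polynomial 𝕜 ⊗[𝕜] Mq q :=
  lift q (fun i j ↦ Polynomial.X ⊗ₜ[𝕜] T q i j) (by
    intro x y h
    cases h <;>
    simp only [map_mul, map_smul, map_sub, FreeAlgebra.lift_ι_apply,
      Algebra.TensorProduct.tmul_mul_tmul, ba, ca, db, dc, cb, da,
      TensorProduct.tmul_smul, TensorProduct.tmul_sub]
    abel)

/-- The derivation `∂ : 𝕜[X] → 𝕜` with `∂ (X ^ n) = n`, i.e. `p ↦ p'(1)`. -/
def polyDer (𝕜 : Type*) [Field 𝕜] : Polynomial 𝕜 →ₗ[𝕜] 𝕜 :=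
  Polynomial.leval 1 ∘ₗ Polynomial.derivative

/-- The derivation `∂_q`, `ξ ↦ ∂ (ξ₋₁) ε (ξ₀)`. -/
def der : Mq q →ₗ[𝕜] 𝕜 :=
  (TensorProduct.lid 𝕜 𝕜).toLinearMap ∘ₗ
    TensorProduct.map (polyDer 𝕜) (counit (R := 𝕜) (A := Mq q)) ∘ₗ
      (degCoaction q).toLinearMap

/-- The homogeneous elements of degree `n`: the span of the products of `n` generators. -/
def homogeneous (n : ℕ) : Submodule 𝕜 (Mq q) :=
  (Submodule.span 𝕜 {α q, β q, γ q, δ q}) ^ n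

/-- The quantum determinant. -/
def det : Mq q := α q * δ q - (q : 𝕜)⁻¹ • (β q * γ q)

theorem comul_det : comul (R := 𝕜) (det q) = det q ⊗ₜ[𝕜] det q := by
  have hq : (q : 𝕜) ≠ 0 := q.ne_zero
  simp only [det, map_sub, map_smul, Bialgebra.comul_mul, comul_T, Fin.sum_univ_two, add_mul,
      mul_add, Algebra.TensorProduct.tmul_mul_tmul, ba, dc, cb, da,
      ← TensorProduct.smul_tmul', TensorProduct.tmul_smul, TensorProduct.sub_tmul,
      TensorProduct.tmul_sub, smul_add, smul_sub, smul_smul]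
  match_scalars <;> (try field_simp) <;> ring

theorem counit_det : counit (R := 𝕜) (det q) = 1 := by
  simp [det, counit_T]

/-- The values of the standard R-form on the generators; `s` is a square root of `q`. -/
def HasStandardValues (s : 𝕜ˣ) (R : Mq q ⊗[𝕜] Mq q →ₗ[𝕜] 𝕜) : Prop :=
  !![R (α q ⊗ₜ α q), R (β q ⊗ₜ β q), R (α q ⊗ₜ β q), R (β q ⊗ₜ α q);
     R (γ q ⊗ₜ γ q), R (δ q ⊗ₜ δ q), R (γ q ⊗ₜ δ q), R (δ q ⊗ₜ γ q);
     R (α q ⊗ₜ γ q), R (β q ⊗ₜ δ q), R (α q ⊗ₜ δ q), R (β q ⊗ₜ γ q);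
     R (γ q ⊗ₜ α q), R (δ q ⊗ₜ β q), R (γ q ⊗ₜ β q), R (δ q ⊗ₜ α q)] =
  (s : 𝕜)⁻¹ •
  !![(q : 𝕜), 0, 0, 0;
     0, (q : 𝕜), 0, 0;
     0, 0, 1, (q : 𝕜) - (q : 𝕜)⁻¹;
     0, 0, 0, 1]

/-- The standard R-form on `M_q(2)`: the universal R-form with the standard values on
generators. -/
structure IsStandardRForm (s : 𝕜ˣ) (R : ConvUnits 𝕜 (Mq q)) : Prop where
  coquasitriangular : IsCoquasitriangular R
  values : HasStandardValues q s R.val.ofConv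

end Mq

/-- The relation `θ det_q = 1` on `M_q(2)[θ]`. -/
inductive GLRel : Polynomial (Mq q) → Polynomial (Mq q) → Prop
  | mk : GLRel (Polynomial.X * Polynomial.C (Mq.det q)) 1

/-- The quantum group `GL_q(2) = M_q(2)[θ] / (θ det_q - 1)`. -/
def GLq : Type _ := RingQuot (GLRel q)

instance : Ring (GLq q) := inferInstanceAs (Ring (RingQuot (GLRel q)))
instance : Algebra 𝕜 (GLq q) := inferInstanceAs (Algebra 𝕜 (RingQuot (GLRel q)))

namespace GLq

/-- The projection `M_q(2)[θ] → GL_q(2)`. -/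
def mk : Polynomial (Mq q) →ₐ[𝕜] GLq q := RingQuot.mkAlgHom 𝕜 (GLRel q)

/-- The canonical map `M_q(2) → GL_q(2)`. -/
def ofMq : Mq q →ₐ[𝕜] GLq q := (mk q).comp Polynomial.CAlgHom

def θ : GLq q := mk q Polynomial.X

theorem θ_mul_det : θ q * ofMq q (Mq.det q) = 1 := by
  have h : mk q (Polynomial.X * Polynomial.C (Mq.det q)) = mk q 1 :=
    RingQuot.mkAlgHom_rel 𝕜 GLRel.mk
  rwa [map_mul, map_one] at h

theorem ofMq_comm (x : Mq q) : Commute (ofMq q x) (θ q) := by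
  have h := congrArg (mk q) (Polynomial.X_mul_C x).symm
  rwa [map_mul, map_mul] at h

variable {B : Type*} [Ring B] [Algebra 𝕜 B]

def lift (f : Mq q →ₐ[𝕜] B) (t : B) (hc : ∀ x, Commute (f x) t) (h : t * f (Mq.det q) = 1) :
    GLq q →ₐ[𝕜] B :=
  RingQuot.liftAlgHom 𝕜 ⟨Polynomial.eval₂AlgHom f t hc, by
    rintro _ _ ⟨⟩
    rw [map_mul, map_one]
    simpa [-map_mul] using h⟩

theorem lift_mk (f : Mq q →ₐ[𝕜] B) (t : B) (hc) (h) (p : Polynomial (Mq q)) :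
    lift q f t hc h (mk q p) = Polynomial.eval₂AlgHom f t hc p :=
  RingQuot.liftAlgHom_mkAlgHom_apply _ _ _ _

theorem lift_ofMq (f : Mq q →ₐ[𝕜] B) (t : B) (hc) (h) (x : Mq q) :
    lift q f t hc h (ofMq q x) = f x := by
  simp [ofMq, lift_mk]

theorem lift_θ (f : Mq q →ₐ[𝕜] B) (t : B) (hc) (h) : lift q f t hc h (θ q) = t := by
  simp [θ, lift_mk]

theorem algHom_ext {f g : GLq q →ₐ[𝕜] B} (h : ∀ i j, f (ofMq q (Mq.T q i j)) =
    g (ofMq q (Mq.T q i j))) (hθ : f (θ q) = g (θ q)) : f = g := by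
  refine RingQuot.ringQuot_ext' 𝕜 f g (Polynomial.algHom_ext' ?_ hθ)
  exact Mq.algHom_ext q h

/-- The comultiplication, extending that of `M_q(2)`, with `θ` grouplike. -/
def comulHom : GLq q →ₐ[𝕜] GLq q ⊗[𝕜] GLq q :=
  lift q ((Algebra.TensorProduct.map (ofMq q) (ofMq q)).comp (Bialgebra.comulAlgHom 𝕜 (Mq q)))
    (θ q ⊗ₜ θ q)
    (fun x ↦ by
      simp only [AlgHom.comp_apply]
      induction Bialgebra.comulAlgHom 𝕜 (Mq q) x using TensorProduct.induction_on with
      | zero => simp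
      | tmul a b =>
        simp [Commute, SemiconjBy, (ofMq_comm q a).eq, (ofMq_comm q b).eq]
      | add a b ha hb => rw [map_add]; exact ha.add_left hb)
    (by simp [Mq.comul_det, θ_mul_det, Algebra.TensorProduct.one_def])

def counitHom : GLq q →ₐ[𝕜] 𝕜 :=
  lift q (Bialgebra.counitAlgHom 𝕜 (Mq q)) 1 (fun _ ↦ Commute.one_right _)
    (by simp [Mq.counit_det])

instance : Bialgebra 𝕜 (GLq q) :=
  Bialgebra.ofAlgHom (comulHom q) (counitHom q)
    (algHom_ext q
      (fun i j ↦ by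
        simp [comulHom, lift_ofMq, Mq.comul_T, TensorProduct.tmul_add, TensorProduct.add_tmul]
        abel)
      (by simp [comulHom, lift_θ]))
    (algHom_ext q
      (fun i j ↦ by
        fin_cases i <;> fin_cases j <;>
          simp [comulHom, counitHom, lift_ofMq, Mq.comul_T, Mq.counit_T])
      (by simp [comulHom, counitHom, lift_θ]))
    (algHom_ext q
      (fun i j ↦ by
        fin_cases i <;> fin_cases j <;>
          simp [comulHom, counitHom, lift_ofMq, Mq.comul_T, Mq.counit_T])
      (by simp [comulHom, counitHom, lift_θ]))

/-- The counit of `M_q(2)[θ]`, with `θ ↦ 1`. -/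
def polyCounit : Polynomial (Mq q) →ₐ[𝕜] 𝕜 :=
  Polynomial.eval₂AlgHom (Bialgebra.counitAlgHom 𝕜 (Mq q)) 1 fun _ ↦ Commute.one_right _

/-- `D` is a derivation on `M_q(2)[θ]` that restricts to `∂_q` and maps `θ` to `-2`. -/
structure IsHatDer (D : Polynomial (Mq q) →ₗ[𝕜] 𝕜) : Prop where
  derivation : IsPointDerivation (polyCounit q) D
  restrict : ∀ ξ : Mq q, D (Polynomial.C ξ) = Mq.der q ξ
  map_θ : D Polynomial.X = -2

/-- The universal R-form on `GL_q(2)` extending the given form `R` on `M_q(2)`. -/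
structure IsExtendedRForm (R : ConvUnits 𝕜 (Mq q)) (S : ConvUnits 𝕜 (GLq q)) : Prop where
  coquasitriangular : IsCoquasitriangular S
  extends_form : ∀ ξ η : Mq q,
    S.val.ofConv (ofMq q ξ ⊗ₜ[𝕜] ofMq q η) = R.val.ofConv (ξ ⊗ₜ[𝕜] η)

end GLq
end Mq
end

/-! The infinitesimal part rests on centrality. Call a functional `D` central if `D(x₁) x₂ = x₁
D(x₂)`. If `D` is a derivation along `ε` and is central, then `D ⊗ D` and `D ⊗ ε ⊗ D` commute with
everything under convolution. Conjugation by `R` is then trivial, the two hexagon-type identities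
reduce to the Leibniz rule, and the Cartier identity holds because `D ⊗ D` is symmetric
(`isCartier_tensorForm`). Centrality need only be tested on generators (`isCentral_of_adjoin`),
where `∂_q(T i j) = ε(T i j)` makes it immediate. The derivation extends to `GL_q(2)` as a character
with values in the dual numbers: `det_q ↦ 1 + 2ε` forces `θ ↦ 1 - 2ε`.

For the R-form, the two multiplicativity axioms say that `a ↦ R(a ⊗ ·)` is an algebra map into the
dual convolution algebra and that `b ↦ R(· ⊗ b)` is an anti-homomorphism. Uniqueness follows by
using generators in one argument and then in the other.

Existence is the Faddeev–Reshetikhin–Takhtajan construction. The prescribed values define a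
two-dimensional representation `rep`. Its coefficients satisfy the Manin relations because the
braiding matrix commutes with the tensor square of `rep` (`braiding_mul_repSq`, `coord_rel`), so
they define a pairing. The normalisation `s ^ 2 = q` makes `det_q` pair trivially (`pairingMq_det`),
so the pairing lives on `GL_q(2)`, where the antipode supplies the convolution inverse (`formUnit`).
Each remaining axiom is recast as an equality or an intertwining of algebra maps and checked on
generators. The form on `M_q(2)` is the restriction of the one on `GL_q(2)`. -/

namespace ConvolutionForm

/-! ### Functoriality of convolution algebras, and their constants. -/

section Convolution

variable {𝕜 : Type*} [Field 𝕜]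
variable {A : Type*} [Ring A] [Algebra 𝕜 A]
variable {B C : Type*} [AddCommGroup B] [Module 𝕜 B] [Coalgebra 𝕜 B]
  [AddCommGroup C] [Module 𝕜 C] [Coalgebra 𝕜 C]

/-- Precomposition with a coalgebra map, as a map of convolution algebras. -/
noncomputable def precomp (A : Type*) [Ring A] [Algebra 𝕜 A] (h : B →ₗc[𝕜] C) :
    WithConv (C →ₗ[𝕜] A) →ₐ[𝕜] WithConv (B →ₗ[𝕜] A) :=
  AlgHom.ofLinearMap
    { toFun := fun f ↦ toConv (f.ofConv ∘ₗ h.toLinearMap)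
      map_add' := fun _ _ ↦ rfl
      map_smul' := fun _ _ ↦ rfl }
    (by ext x; simp)
    (fun f g ↦ congrArg toConv (LinearMap.convMul_comp_coalgHom_distrib f g h))

@[simp]
theorem precomp_apply (h : B →ₗc[𝕜] C) (f : WithConv (C →ₗ[𝕜] A)) (x : B) :
    precomp A h f x = f (h x) := rfl

/-- Postcomposition with an algebra map, as a map of convolution algebras. -/
noncomputable def postcomp (C : Type*) [AddCommGroup C] [Module 𝕜 C] [Coalgebra 𝕜 C]
    {A' : Type*} [Ring A'] [Algebra 𝕜 A'] (h : A →ₐ[𝕜] A') :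
    WithConv (C →ₗ[𝕜] A) →ₐ[𝕜] WithConv (C →ₗ[𝕜] A') :=
  AlgHom.ofLinearMap
    { toFun := fun f ↦ toConv (h.toLinearMap ∘ₗ f.ofConv)
      map_add' := fun f g ↦ by ext; simp
      map_smul' := fun c f ↦ by ext; simp }
    (by ext x; simp)
    (fun f g ↦ congrArg toConv (LinearMap.algHom_comp_convMul_distrib h f g))

theorem sum_counit_right_smul {ι : Type*} {x : C} (r : Coalgebra.Repr 𝕜 x ι) :
    ∑ i ∈ r.index, counit (R := 𝕜) (r.right i) • r.left i = x := by
  have h := congrArg (TensorProduct.rid 𝕜 C) (Coalgebra.sum_tmul_counit_eq r)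
  simpa only [map_sum, TensorProduct.rid_tmul, one_smul] using h

/-- The constant `c ↦ ε(c) a` in a convolution algebra. -/
noncomputable def constMap (C : Type*) [AddCommGroup C] [Module 𝕜 C] [Coalgebra 𝕜 C] (a : A) :
    WithConv (C →ₗ[𝕜] A) :=
  toConv ((counit (R := 𝕜) (A := C)).smulRight a)

@[simp]
theorem constMap_apply (a : A) (x : C) :
    constMap (𝕜 := 𝕜) C a x = counit (R := 𝕜) x • a := rfl

theorem mul_constMap_apply (f : WithConv (C →ₗ[𝕜] A)) (a : A) (x : C) :
    (f * constMap (𝕜 := 𝕜) C a) x = f x * a := by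
  conv_rhs => rw [← sum_counit_right_smul (ℛ 𝕜 x)]
  simp [(ℛ 𝕜 x).convMul_apply, Finset.sum_mul]

theorem constMap_mul_apply (f : WithConv (C →ₗ[𝕜] A)) (a : A) (x : C) :
    (constMap (𝕜 := 𝕜) C a * f) x = a * f x := by
  conv_rhs => rw [← Coalgebra.sum_counit_smul (ℛ 𝕜 x)]
  simp [(ℛ 𝕜 x).convMul_apply, Finset.mul_sum]

variable (𝕜 A) in
/-- The inclusion of the constants into a convolution algebra. -/
noncomputable def const (C : Type*) [AddCommGroup C] [Module 𝕜 C] [Coalgebra 𝕜 C] :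
    A →ₐ[𝕜] WithConv (C →ₗ[𝕜] A) :=
  AlgHom.ofLinearMap
    { toFun := constMap C
      map_add' := fun a b ↦ by ext; simp
      map_smul' := fun c a ↦ by ext x; simp [smul_comm _ c a] }
    (by ext x; simp [Algebra.algebraMap_eq_smul_one])
    (fun a b ↦ by
      ext x
      exact ((constMap_mul_apply (constMap C b) a x).trans (mul_smul_comm _ _ _)).symm)

theorem const_eq (a : A) : const 𝕜 A C a = constMap C a := rfl

end Convolution

/-! ### R-forms as algebra maps into the dual convolution algebra. -/

section Legs

variable {𝕜 : Type*} [Field 𝕜]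
variable {H K A : Type*} [Ring H] [Bialgebra 𝕜 H] [Ring K] [Bialgebra 𝕜 K]
  [Ring A] [Algebra 𝕜 A]

variable (𝕜 H K) in
/-- The projection `a ⊗ b ↦ ε(b) a`. -/
noncomputable def fstProj : H ⊗[𝕜] K →ₐc[𝕜] H :=
  (Bialgebra.TensorProduct.rid 𝕜 𝕜 H : H ⊗[𝕜] 𝕜 →ₐc[𝕜] H).comp
    (Bialgebra.TensorProduct.map (BialgHom.id 𝕜 H) (Bialgebra.counitBialgHom 𝕜 K))

variable (𝕜 H K) in
/-- The projection `a ⊗ b ↦ ε(a) b`. -/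
noncomputable def sndProj : H ⊗[𝕜] K →ₐc[𝕜] K :=
  (Bialgebra.TensorProduct.lid 𝕜 K : 𝕜 ⊗[𝕜] K →ₐc[𝕜] K).comp
    (Bialgebra.TensorProduct.map (Bialgebra.counitBialgHom 𝕜 H) (BialgHom.id 𝕜 K))

/-- The projection of `H ⊗ H ⊗ H` to the first two factors. -/
noncomputable def proj12 : H ⊗[𝕜] (H ⊗[𝕜] H) →ₐc[𝕜] H ⊗[𝕜] H :=
  Bialgebra.TensorProduct.map (BialgHom.id 𝕜 H) (fstProj 𝕜 H H)

theorem leg12_eq (f : H ⊗[𝕜] H →ₗ[𝕜] 𝕜) :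
    leg12 f = precomp 𝕜 (proj12 (𝕜 := 𝕜) (H := H)).toCoalgHom (toConv f) := by
  refine congrArg toConv (TensorProduct.ext' fun a x ↦ ?_)
  induction x with
  | zero => simp
  | add x y hx hy => rw [TensorProduct.tmul_add, map_add, map_add, hx, hy]
  | tmul b c =>
    change f (a ⊗ₜ b) * counit c = f (a ⊗ₜ (counit (R := 𝕜) c • b))
    simp [mul_comm]

theorem leg23_eq (f : H ⊗[𝕜] H →ₗ[𝕜] 𝕜) :
    leg23 f = precomp 𝕜 (sndProj 𝕜 H (H ⊗[𝕜] H)).toCoalgHom (toConv f) := by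
  refine congrArg toConv (TensorProduct.ext' fun a x ↦ ?_)
  change counit a * f x = f (counit (R := 𝕜) a • x)
  simp

theorem leg12_apply (f : H ⊗[𝕜] H →ₗ[𝕜] 𝕜) (a b c : H) :
    leg12 f (a ⊗ₜ (b ⊗ₜ c)) = f (a ⊗ₜ b) * counit c := rfl

theorem leg13_apply (f : H ⊗[𝕜] H →ₗ[𝕜] 𝕜) (a b c : H) :
    leg13 f (a ⊗ₜ (b ⊗ₜ c)) = counit b * f (a ⊗ₜ c) := rfl

theorem leg23_apply (f : H ⊗[𝕜] H →ₗ[𝕜] 𝕜) (a b c : H) :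
    leg23 f (a ⊗ₜ (b ⊗ₜ c)) = counit a * f (b ⊗ₜ c) := rfl

/-- The map `a ↦ f (a ⊗ ·)` into the convolution algebra. -/
noncomputable def leftConv (f : H ⊗[𝕜] K →ₗ[𝕜] 𝕜) : H →ₗ[𝕜] WithConv (K →ₗ[𝕜] 𝕜) :=
  (WithConv.linearEquiv 𝕜 (K →ₗ[𝕜] 𝕜)).symm.toLinearMap ∘ₗ TensorProduct.curry f

/-- The map `b ↦ f (· ⊗ b)` into the convolution algebra. -/
noncomputable def rightConv (f : H ⊗[𝕜] K →ₗ[𝕜] 𝕜) : K →ₗ[𝕜] WithConv (H →ₗ[𝕜] 𝕜) :=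
  leftConv (f ∘ₗ (TensorProduct.comm 𝕜 K H).toLinearMap)

@[simp]
theorem leftConv_apply (f : H ⊗[𝕜] K →ₗ[𝕜] 𝕜) (a : H) (b : K) :
    leftConv f a b = f (a ⊗ₜ b) := rfl

@[simp]
theorem rightConv_apply (f : H ⊗[𝕜] K →ₗ[𝕜] 𝕜) (a : H) (b : K) :
    rightConv f b a = f (a ⊗ₜ b) := rfl

theorem leg13_mul_leg23_apply (f : H ⊗[𝕜] H →ₗ[𝕜] 𝕜) (a b c : H) :
    (leg13 f * leg23 f) (a ⊗ₜ (b ⊗ₜ c)) = (leftConv f a * leftConv f b) c := by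
  rw [((ℛ 𝕜 a).tmul ((ℛ 𝕜 b).tmul (ℛ 𝕜 c))).convMul_apply, (ℛ 𝕜 c).convMul_apply]
  conv_rhs => rw [← sum_counit_right_smul (ℛ 𝕜 a), ← Coalgebra.sum_counit_smul (ℛ 𝕜 b)]
  simp only [Coalgebra.Repr.tmul_index, Coalgebra.Repr.tmul_left, Coalgebra.Repr.tmul_right,
    Finset.sum_product, leg13_apply, leg23_apply, map_sum, map_smul, ofConv_sum, ofConv_smul,
    LinearMap.sum_apply, LinearMap.smul_apply, leftConv_apply, Finset.sum_mul_sum, smul_eq_mul]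
  rw [Finset.sum_congr rfl fun i _ ↦ Finset.sum_comm, Finset.sum_comm]
  refine Finset.sum_congr rfl fun k _ ↦ Finset.sum_congr rfl fun i _ ↦
    Finset.sum_congr rfl fun j _ ↦ ?_
  ring

theorem leg13_mul_leg12_apply (f : H ⊗[𝕜] H →ₗ[𝕜] 𝕜) (a b c : H) :
    (leg13 f * leg12 f) (a ⊗ₜ (b ⊗ₜ c)) = (rightConv f c * rightConv f b) a := by
  rw [((ℛ 𝕜 a).tmul ((ℛ 𝕜 b).tmul (ℛ 𝕜 c))).convMul_apply, (ℛ 𝕜 a).convMul_apply]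
  conv_rhs => rw [← sum_counit_right_smul (ℛ 𝕜 c), ← Coalgebra.sum_counit_smul (ℛ 𝕜 b)]
  simp only [Coalgebra.Repr.tmul_index, Coalgebra.Repr.tmul_left, Coalgebra.Repr.tmul_right,
    Finset.sum_product, leg13_apply, leg12_apply, map_sum, map_smul, ofConv_sum, ofConv_smul,
    LinearMap.sum_apply, LinearMap.smul_apply, rightConv_apply, Finset.sum_mul_sum, smul_eq_mul]
  refine Finset.sum_congr rfl fun i _ ↦ ?_
  rw [Finset.sum_comm]
  refine Finset.sum_congr rfl fun k _ ↦ Finset.sum_congr rfl fun j _ ↦ ?_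
  ring

/-- The axiom reads `R(ab ⊗ c) = R(a ⊗ c₁) R(b ⊗ c₂)`. In this form an R-form can be built, and
compared with another, through generators and relations in its left argument. -/
theorem formMulLeft_eq_iff (f : H ⊗[𝕜] H →ₗ[𝕜] 𝕜) :
    formMulLeft f = leg13 f * leg23 f ↔
      ∀ a b, leftConv f (a * b) = leftConv f a * leftConv f b := by
  constructor
  · intro h a b
    ext c
    rw [← leg13_mul_leg23_apply, ← h]
    rfl
  · intro h
    refine WithConv.ext (TensorProduct.ext_threefold' fun a b c ↦ ?_)
    rw [leg13_mul_leg23_apply, ← h]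
    rfl

/-- Here the axiom reads `R(a ⊗ bc) = R(a₁ ⊗ c) R(a₂ ⊗ b)`. The order of `b` and `c` is reversed,
which is why opposite algebras and transposes appear later. -/
theorem formMulRight_eq_iff (f : H ⊗[𝕜] H →ₗ[𝕜] 𝕜) :
    formMulRight f = leg13 f * leg12 f ↔
      ∀ b c, rightConv f (b * c) = rightConv f c * rightConv f b := by
  constructor
  · intro h b c
    ext a
    rw [← leg13_mul_leg12_apply, ← h]
    rfl
  · intro h
    refine WithConv.ext (TensorProduct.ext_threefold' fun a b c ↦ ?_)
    rw [leg13_mul_leg12_apply, ← h]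
    rfl

theorem convMul_tmul_one (f g : WithConv (H ⊗[𝕜] K →ₗ[𝕜] 𝕜)) :
    leftConv (f * g).ofConv 1 = leftConv f.ofConv 1 * leftConv g.ofConv 1 := by
  ext b
  rw [(ℛ 𝕜 b).convMul_apply, leftConv_apply]
  simp [← (ℛ 𝕜 b).eq, Algebra.TensorProduct.one_def, TensorProduct.tmul_sum]

theorem convMul_one_tmul (f g : WithConv (H ⊗[𝕜] K →ₗ[𝕜] 𝕜)) :
    rightConv (f * g).ofConv 1 = rightConv f.ofConv 1 * rightConv g.ofConv 1 := by
  ext b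
  rw [(ℛ 𝕜 b).convMul_apply, rightConv_apply]
  simp [← (ℛ 𝕜 b).eq, Algebra.TensorProduct.one_def, TensorProduct.sum_tmul]

/-- The functional `R(1 ⊗ ·)` is idempotent by multiplicativity and has an inverse, the restriction
of `R⁻¹`. An invertible idempotent is `1`. -/
theorem leftConv_one_eq_one {R : ConvUnits 𝕜 H} (hR : IsCoquasitriangular R) :
    leftConv R.val.ofConv 1 = 1 := by
  have h1 : leftConv (1 : WithConv (H ⊗[𝕜] H →ₗ[𝕜] 𝕜)).ofConv 1 = 1 := by
    ext b; simp
  have h2 := convMul_tmul_one R.val R⁻¹.val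
  rw [R.mul_inv, h1] at h2
  have h3 := (formMulLeft_eq_iff _).1 hR.mul_left 1 1
  rw [one_mul] at h3
  calc leftConv R.val.ofConv 1
      = leftConv R.val.ofConv 1 * (leftConv R.val.ofConv 1 * leftConv R⁻¹.val.ofConv 1) := by
        rw [← h2, mul_one]
    _ = 1 := by rw [← mul_assoc, ← h3, ← h2]

theorem rightConv_one_eq_one {R : ConvUnits 𝕜 H} (hR : IsCoquasitriangular R) :
    rightConv R.val.ofConv 1 = 1 := by
  have h1 : rightConv (1 : WithConv (H ⊗[𝕜] H →ₗ[𝕜] 𝕜)).ofConv 1 = 1 := by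
    ext b; simp
  have h2 := convMul_one_tmul R.val R⁻¹.val
  rw [R.mul_inv, h1] at h2
  have h3 := (formMulRight_eq_iff _).1 hR.mul_right 1 1
  rw [one_mul] at h3
  calc rightConv R.val.ofConv 1
      = rightConv R.val.ofConv 1 * (rightConv R.val.ofConv 1 * rightConv R⁻¹.val.ofConv 1) := by
        rw [← h2, mul_one]
    _ = 1 := by rw [← mul_assoc, ← h3, ← h2]

/-- A universal R-form as an algebra map into the convolution algebra. -/
noncomputable def leftHom {R : ConvUnits 𝕜 H} (hR : IsCoquasitriangular R) :
    H →ₐ[𝕜] WithConv (H →ₗ[𝕜] 𝕜) :=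
  AlgHom.ofLinearMap (leftConv R.val.ofConv) (leftConv_one_eq_one hR)
    ((formMulLeft_eq_iff _).1 hR.mul_left)

/-- A universal R-form as an algebra map into the opposite of the convolution algebra. -/
noncomputable def rightHom {R : ConvUnits 𝕜 H} (hR : IsCoquasitriangular R) :
    H →ₐ[𝕜] (WithConv (H →ₗ[𝕜] 𝕜))ᵐᵒᵖ :=
  AlgHom.ofLinearMap ((MulOpposite.opLinearEquiv 𝕜).toLinearMap ∘ₗ rightConv R.val.ofConv)
    (congrArg MulOpposite.op (rightConv_one_eq_one hR))
    fun a b ↦ congrArg MulOpposite.op ((formMulRight_eq_iff _).1 hR.mul_right a b)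

end Legs

/-! ### Central functionals on a coalgebra. -/

section Central

variable {𝕜 : Type*} [Field 𝕜]
variable {A C : Type*} [Ring A] [Algebra 𝕜 A] [AddCommGroup C] [Module 𝕜 C] [Coalgebra 𝕜 C]

/-- A functional `f` on a coalgebra is central if `f(x₁) x₂ = x₁ f(x₂)` for all `x`. -/
def IsCentral (f : C →ₗ[𝕜] 𝕜) : Prop :=
  (TensorProduct.lid 𝕜 C).toLinearMap ∘ₗ f.rTensor C ∘ₗ comul =
    (TensorProduct.rid 𝕜 C).toLinearMap ∘ₗ f.lTensor C ∘ₗ comul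

theorem isCentral_iff (f : C →ₗ[𝕜] 𝕜) : IsCentral f ↔ ∀ x : C,
    TensorProduct.lid 𝕜 C (f.rTensor C (comul x)) =
      TensorProduct.rid 𝕜 C (f.lTensor C (comul x)) :=
  LinearMap.ext_iff

theorem lid_rTensor_comul {ι : Type*} {x : C} (r : Coalgebra.Repr 𝕜 x ι) (f : C →ₗ[𝕜] 𝕜) :
    TensorProduct.lid 𝕜 C (f.rTensor C (comul x)) = ∑ i ∈ r.index, f (r.left i) • r.right i := by
  simp [← r.eq]

theorem rid_lTensor_comul {ι : Type*} {x : C} (r : Coalgebra.Repr 𝕜 x ι) (f : C →ₗ[𝕜] 𝕜) :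
    TensorProduct.rid 𝕜 C (f.lTensor C (comul x)) = ∑ i ∈ r.index, f (r.right i) • r.left i := by
  simp [← r.eq]

theorem IsCentral.sum_eq {f : C →ₗ[𝕜] 𝕜} (hf : IsCentral f) {ι : Type*} {x : C}
    (r : Coalgebra.Repr 𝕜 x ι) :
    ∑ i ∈ r.index, f (r.left i) • r.right i = ∑ i ∈ r.index, f (r.right i) • r.left i := by
  rw [← lid_rTensor_comul, ← rid_lTensor_comul]
  exact LinearMap.congr_fun hf x

/-- Applying `g` to the centrality identity suffices, since scalars are central in `A`. Allowing
general `A` covers both scalar forms and the `H`-valued multiplication map. -/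
theorem IsCentral.commute {f : C →ₗ[𝕜] 𝕜} (hf : IsCentral f) (g : WithConv (C →ₗ[𝕜] A)) :
    toConv (Algebra.linearMap 𝕜 A ∘ₗ f) * g = g * toConv (Algebra.linearMap 𝕜 A ∘ₗ f) := by
  ext x
  have h := congrArg g.ofConv (hf.sum_eq (ℛ 𝕜 x))
  simpa [(ℛ 𝕜 x).convMul_apply, Algebra.smul_def, Algebra.commutes] using h

theorem IsCentral.commute_form {f : C →ₗ[𝕜] 𝕜} (hf : IsCentral f) (g : WithConv (C →ₗ[𝕜] 𝕜)) :
    toConv f * g = g * toConv f :=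
  hf.commute g

theorem isCentral_counit : IsCentral (counit (R := 𝕜) (A := C)) := by
  rw [isCentral_iff]
  intro x
  rw [lid_rTensor_comul (ℛ 𝕜 x), rid_lTensor_comul (ℛ 𝕜 x), Coalgebra.sum_counit_smul,
    sum_counit_right_smul]

end Central

/-! ### Central derivations give Cartier structures. -/

section Cartier

variable {𝕜 : Type*} [Field 𝕜] {H : Type*} [Ring H] [Bialgebra 𝕜 H]

theorem IsCentral.tmul {K : Type*} [Ring K] [Bialgebra 𝕜 K] {f : H →ₗ[𝕜] 𝕜} {g : K →ₗ[𝕜] 𝕜}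
    (hf : IsCentral f) (hg : IsCentral g) :
    IsCentral ((TensorProduct.lid 𝕜 𝕜).toLinearMap ∘ₗ TensorProduct.map f g) := by
  refine TensorProduct.ext' fun a b ↦ ?_
  change TensorProduct.lid 𝕜 (H ⊗[𝕜] K) (LinearMap.rTensor _ _ (comul (a ⊗ₜ b))) =
    TensorProduct.rid 𝕜 (H ⊗[𝕜] K) (LinearMap.lTensor _ _ (comul (a ⊗ₜ b)))
  rw [lid_rTensor_comul ((ℛ 𝕜 a).tmul (ℛ 𝕜 b)), rid_lTensor_comul ((ℛ 𝕜 a).tmul (ℛ 𝕜 b))]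
  have h := congrArg₂ (fun x y ↦ x ⊗ₜ[𝕜] y) (hf.sum_eq (ℛ 𝕜 a)) (hg.sum_eq (ℛ 𝕜 b))
  simp_rw [TensorProduct.sum_tmul, TensorProduct.tmul_sum, TensorProduct.smul_tmul_smul] at h
  simpa [Finset.sum_product] using h

/-- Both `x ↦ D(x₁) x₂` and `x ↦ x₁ D(x₂)` satisfy the Leibniz rule as maps `H → H` (`hl` and `hr`),
so they agree as soon as they agree on generators. -/
theorem isCentral_of_adjoin {D : H →ₗ[𝕜] 𝕜}
    (hD : IsPointDerivation (Bialgebra.counitAlgHom 𝕜 H) D) {s : Set H}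
    (hs : Algebra.adjoin 𝕜 s = ⊤)
    (h : ∀ x ∈ s, TensorProduct.lid 𝕜 H (D.rTensor H (comul x)) =
      TensorProduct.rid 𝕜 H (D.lTensor H (comul x))) : IsCentral D := by
  rw [isCentral_iff]
  intro x
  have hx : x ∈ Algebra.adjoin 𝕜 s := hs ▸ Algebra.mem_top
  induction hx using Algebra.adjoin_induction with
  | mem x hx => exact h x hx
  | algebraMap r =>
    simp [Algebra.algebraMap_eq_smul_one, Bialgebra.comul_one, Algebra.TensorProduct.one_def]
  | add x y _ _ hx hy => simp [map_add, hx, hy]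
  | mul x y _ _ hx hy =>
    have hl : TensorProduct.lid 𝕜 H (D.rTensor H (comul (x * y))) =
        TensorProduct.lid 𝕜 H (D.rTensor H (comul x)) * y +
          x * TensorProduct.lid 𝕜 H (D.rTensor H (comul y)) := by
      rw [lid_rTensor_comul ((ℛ 𝕜 x).mul (ℛ 𝕜 y)), lid_rTensor_comul (ℛ 𝕜 x),
        lid_rTensor_comul (ℛ 𝕜 y)]
      trans (∑ i ∈ (ℛ 𝕜 x).index, D ((ℛ 𝕜 x).left i) • (ℛ 𝕜 x).right i) *
          (∑ i ∈ (ℛ 𝕜 y).index, counit (R := 𝕜) ((ℛ 𝕜 y).left i) • (ℛ 𝕜 y).right i) +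
        (∑ i ∈ (ℛ 𝕜 x).index, counit (R := 𝕜) ((ℛ 𝕜 x).left i) • (ℛ 𝕜 x).right i) *
          (∑ i ∈ (ℛ 𝕜 y).index, D ((ℛ 𝕜 y).left i) • (ℛ 𝕜 y).right i)
      swap
      · rw [Coalgebra.sum_counit_smul, Coalgebra.sum_counit_smul]
      simp [Finset.sum_product, Finset.sum_mul_sum, hD _ _, add_smul, Finset.sum_add_distrib,
        smul_smul, mul_comm (D _)]
    have hr : TensorProduct.rid 𝕜 H (D.lTensor H (comul (x * y))) =
        TensorProduct.rid 𝕜 H (D.lTensor H (comul x)) * y +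
          x * TensorProduct.rid 𝕜 H (D.lTensor H (comul y)) := by
      rw [rid_lTensor_comul ((ℛ 𝕜 x).mul (ℛ 𝕜 y)), rid_lTensor_comul (ℛ 𝕜 x),
        rid_lTensor_comul (ℛ 𝕜 y)]
      trans (∑ i ∈ (ℛ 𝕜 x).index, D ((ℛ 𝕜 x).right i) • (ℛ 𝕜 x).left i) *
          (∑ i ∈ (ℛ 𝕜 y).index, counit (R := 𝕜) ((ℛ 𝕜 y).right i) • (ℛ 𝕜 y).left i) +
        (∑ i ∈ (ℛ 𝕜 x).index, counit (R := 𝕜) ((ℛ 𝕜 x).right i) • (ℛ 𝕜 x).left i) *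
          (∑ i ∈ (ℛ 𝕜 y).index, D ((ℛ 𝕜 y).right i) • (ℛ 𝕜 y).left i)
      swap
      · rw [sum_counit_right_smul, sum_counit_right_smul]
      simp [Finset.sum_product, Finset.sum_mul_sum, hD _ _, add_smul, Finset.sum_add_distrib,
        smul_smul, mul_comm (D _)]
    rw [hl, hr, hx, hy]

theorem leg12_mul (f g : WithConv (H ⊗[𝕜] H →ₗ[𝕜] 𝕜)) :
    leg12 (f * g).ofConv = leg12 f.ofConv * leg12 g.ofConv := by
  simp [leg12_eq]

theorem leg23_mul (f g : WithConv (H ⊗[𝕜] H →ₗ[𝕜] 𝕜)) :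
    leg23 (f * g).ofConv = leg23 f.ofConv * leg23 g.ofConv := by
  simp [leg23_eq]

theorem leg12_one : leg12 (1 : WithConv (H ⊗[𝕜] H →ₗ[𝕜] 𝕜)).ofConv = 1 := by
  simp [leg12_eq]

theorem leg23_one : leg23 (1 : WithConv (H ⊗[𝕜] H →ₗ[𝕜] 𝕜)).ofConv = 1 := by
  simp [leg23_eq]

theorem isCartier_tensorForm {R : ConvUnits 𝕜 H} (hR : IsCoquasitriangular R) {D : H →ₗ[𝕜] 𝕜}
    (hD : IsPointDerivation (Bialgebra.counitAlgHom 𝕜 H) D) (hc : IsCentral D) :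
    IsCartier R (tensorForm D D) := by
  -- The (1,3)-leg is `D ⊗ ε ⊗ D`, a tensor product of central functionals, so conjugating it by any
  -- leg of `R` changes nothing.
  have h13 : IsCentral (leg13 (tensorForm D D)).ofConv := by
    have h := hc.tmul ((isCentral_counit (𝕜 := 𝕜) (C := H)).tmul hc)
    convert h using 1
    refine TensorProduct.ext_threefold' fun a b c ↦ ?_
    change counit b * (D a * D c) = D a * (counit b * D c)
    ring
  have hχ : IsCentral (tensorForm D D) := hc.tmul hc
  refine ⟨⟨hR, ?_, ?_, ?_⟩, ?_⟩
  · exact hχ.commute _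
  · have h : leg12 R⁻¹.val.ofConv * leg13 (tensorForm D D) * leg12 R.val.ofConv =
        leg13 (tensorForm D D) := by
      rw [← h13.commute_form, mul_assoc, toConv_ofConv, ← leg12_mul, R.inv_mul, leg12_one, mul_one]
    rw [h]
    refine WithConv.ext (TensorProduct.ext_threefold' fun a b c ↦ ?_)
    change D a * D (b * c) = D a * D b * counit c + counit b * (D a * D c)
    rw [hD, Bialgebra.counitAlgHom_apply, Bialgebra.counitAlgHom_apply]
    ring
  · have h : leg23 R⁻¹.val.ofConv * leg13 (tensorForm D D) * leg23 R.val.ofConv =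
        leg13 (tensorForm D D) := by
      rw [← h13.commute_form, mul_assoc, toConv_ofConv, ← leg23_mul, R.inv_mul, leg23_one, mul_one]
    rw [h]
    refine WithConv.ext (TensorProduct.ext_threefold' fun a b c ↦ ?_)
    change D (a * b) * D c = counit a * (D b * D c) + counit b * (D a * D c)
    rw [hD, Bialgebra.counitAlgHom_apply, Bialgebra.counitAlgHom_apply]
    ring
  · have h : tensorForm D D ∘ₗ (TensorProduct.comm 𝕜 H H).toLinearMap = tensorForm D D :=
      TensorProduct.ext' fun a b ↦ mul_comm (D b) (D a)
    rw [h, hχ.commute_form]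

end Cartier

end ConvolutionForm

namespace Mq

variable {𝕜 : Type*} [Field 𝕜] (q : 𝕜ˣ)

theorem adjoin_T :
    Algebra.adjoin 𝕜 (Set.range fun p : Fin 2 × Fin 2 ↦ T q p.1 p.2) = ⊤ := by
  refine Algebra.eq_top_iff.2 fun x ↦ ?_
  obtain ⟨y, rfl⟩ : ∃ y, mk q y = x := RingQuot.mkAlgHom_surjective 𝕜 (ManinRel q) x
  induction y using FreeAlgebra.induction with
  | grade0 r => rw [AlgHom.commutes]; exact Subalgebra.algebraMap_mem _ r
  | grade1 p => exact Algebra.subset_adjoin ⟨p, rfl⟩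
  | mul a b ha hb => rw [map_mul]; exact mul_mem ha hb
  | add a b ha hb => rw [map_add]; exact add_mem ha hb

/-! ### The derivation `∂_q` -/

/-- On `𝕜[X] ⊗ M_q(2)` the functional `d = ∂ ⊗ ε` is a derivation along the character `e = ev₁ ⊗ ε`.
Pulling back along the algebra map `ρ` keeps this property, and `e ∘ ρ = ε`. -/
theorem der_isPointDerivation : IsPointDerivation (Bialgebra.counitAlgHom 𝕜 (Mq q)) (der q) := by
  let e : Polynomial 𝕜 ⊗[𝕜] Mq q →ₐ[𝕜] 𝕜 :=
    Algebra.TensorProduct.lift (Polynomial.aeval 1) (Bialgebra.counitAlgHom 𝕜 (Mq q))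
      fun _ _ ↦ Commute.all _ _
  let d : Polynomial 𝕜 ⊗[𝕜] Mq q →ₗ[𝕜] 𝕜 :=
    (TensorProduct.lid 𝕜 𝕜).toLinearMap ∘ₗ
      TensorProduct.map (polyDer 𝕜) (counit (R := 𝕜) (A := Mq q))
  have he : e.comp (degCoaction q) = Bialgebra.counitAlgHom 𝕜 (Mq q) :=
    algHom_ext q fun i j ↦ by simp [e, degCoaction, lift_T]
  have hd : ∀ x y, d (x * y) = d x * e y + e x * d y := by
    intro x y
    induction x with
    | zero => simp
    | add a b ha hb => simp only [add_mul, map_add, ha, hb]; ring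
    | tmul p a =>
      induction y with
      | zero => simp
      | add a b ha hb => simp only [mul_add, map_add, ha, hb]; ring
      | tmul r b =>
        simp [d, e, polyDer, Polynomial.aeval_def]
        ring
  intro x y
  have h (z) : Bialgebra.counitAlgHom 𝕜 (Mq q) z = e (degCoaction q z) :=
    (DFunLike.congr_fun he z).symm
  rw [h, h]
  change d (degCoaction q (x * y)) = d (degCoaction q x) * _ + _ * d (degCoaction q y)
  rw [map_mul, hd]

theorem der_T (i j : Fin 2) : der q (T q i j) = if i = j then 1 else 0 := by
  simp [der, degCoaction, lift_T, polyDer, counit_T]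

theorem der_one : der q 1 = 0 := by
  simpa using der_isPointDerivation q 1 1

theorem isCentral_der : ConvolutionForm.IsCentral (der q) := by
  refine ConvolutionForm.isCentral_of_adjoin (der_isPointDerivation q) (adjoin_T q) ?_
  rintro _ ⟨⟨i, j⟩, rfl⟩
  fin_cases i <;> fin_cases j <;> simp [comul_T, der_T]

theorem der_det : der q (det q) = 2 := by
  rw [det, map_sub, map_smul, der_isPointDerivation q, der_isPointDerivation q]
  simp [der_T, counit_T]
  norm_num

theorem der_homogeneous {n : ℕ} {ξ : Mq q} (h : ξ ∈ homogeneous q n) :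
    der q ξ = n * counit (R := 𝕜) ξ := by
  induction h using Submodule.pow_induction_on_left' with
  | algebraMap r => simp [Algebra.algebraMap_eq_smul_one, der_one]
  | add x y i _ _ hx hy => simp [hx, hy, mul_add]
  | mem_mul m hm i x _ hx =>
    have hm' : der q m = counit (R := 𝕜) m := by
      induction hm using Submodule.span_induction with
      | zero => simp
      | add a b _ _ ha hb => simp [ha, hb]
      | smul c a _ ha => simp [ha]
      | mem a ha => rcases ha with rfl | rfl | rfl | rfl <;> simp [der_T, counit_T]
    rw [der_isPointDerivation q, hx, hm']
    simp
    ring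

theorem tensorForm_der_homogeneous {m n : ℕ} {ξ η : Mq q} (hξ : ξ ∈ homogeneous q m)
    (hη : η ∈ homogeneous q n) :
    tensorForm (der q) (der q) (ξ ⊗ₜ[𝕜] η) = m * n * counit (R := 𝕜) (ξ * η) := by
  simp [tensorForm, der_homogeneous q hξ, der_homogeneous q hη]
  ring

theorem tensorForm_der_ne_zero : tensorForm (der q) (der q) ≠ 0 := by
  intro h
  have := LinearMap.congr_fun h (α q ⊗ₜ α q)
  simp [tensorForm, der_T] at this

end Mq

/-! ### Generators, central elements and the extended derivation on `GL_q(2)`. -/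

namespace GLq

variable {𝕜 : Type*} [Field 𝕜] (q : 𝕜ˣ)

theorem adjoin_T_θ : Algebra.adjoin 𝕜
    (insert (θ q) (Set.range fun p : Fin 2 × Fin 2 ↦ ofMq q (Mq.T q p.1 p.2))) = ⊤ := by
  refine Algebra.eq_top_iff.2 fun x ↦ ?_
  obtain ⟨y, rfl⟩ : ∃ y, mk q y = x := RingQuot.mkAlgHom_surjective 𝕜 (GLRel q) x
  have hC (a : Mq q) : mk q (Polynomial.C a) ∈ Algebra.adjoin 𝕜
      (insert (θ q) (Set.range fun p : Fin 2 × Fin 2 ↦ ofMq q (Mq.T q p.1 p.2))) := by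
    have ha : a ∈ Algebra.adjoin 𝕜 (Set.range fun p : Fin 2 × Fin 2 ↦ Mq.T q p.1 p.2) :=
      Mq.adjoin_T q ▸ Algebra.mem_top
    have h : ofMq q a ∈ (Algebra.adjoin 𝕜 _).map (ofMq q) := Subalgebra.mem_map.2 ⟨a, ha, rfl⟩
    rw [AlgHom.map_adjoin (ofMq q)] at h
    refine Algebra.adjoin_mono ?_ h
    rintro _ ⟨_, ⟨p, rfl⟩, rfl⟩
    exact Set.mem_insert_of_mem _ ⟨p, rfl⟩
  induction y using Polynomial.induction_on with
  | C a => exact hC a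
  | add a b ha hb => rw [map_add]; exact add_mem ha hb
  | monomial n a _ =>
    rw [map_mul, map_pow]
    exact mul_mem (hC a) (pow_mem (Algebra.subset_adjoin (Set.mem_insert _ _)) _)

theorem det_mul_θ : ofMq q (Mq.det q) * θ q = 1 := by
  rw [(ofMq_comm q _).eq, θ_mul_det]

theorem commute_θ (x : GLq q) : Commute x (θ q) := by
  have hx : x ∈ Algebra.adjoin 𝕜
    (insert (θ q) (Set.range fun p : Fin 2 × Fin 2 ↦ ofMq q (Mq.T q p.1 p.2))) :=
    adjoin_T_θ q ▸ Algebra.mem_top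
  induction hx using Algebra.adjoin_induction with
  | mem x hx =>
    rcases hx with rfl | ⟨p, rfl⟩
    · exact Commute.refl _
    · exact ofMq_comm q _
  | algebraMap r => exact Algebra.commute_algebraMap_left r _
  | add x y _ _ hx hy => exact hx.add_left hy
  | mul x y _ _ hx hy => exact hx.mul_left hy

/-- The determinant is the inverse of the central element `θ`, so no Manin relation is needed. -/
theorem commute_det (x : GLq q) : Commute x (ofMq q (Mq.det q)) := by
  change x * _ = _ * x
  calc x * ofMq q (Mq.det q)
      = (ofMq q (Mq.det q) * θ q) * x * ofMq q (Mq.det q) := by rw [det_mul_θ, one_mul]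
    _ = ofMq q (Mq.det q) * x * (θ q * ofMq q (Mq.det q)) := by
      simp only [mul_assoc]; rw [← mul_assoc (θ q) x, ← (commute_θ q x).eq, mul_assoc x]
    _ = ofMq q (Mq.det q) * x := by rw [θ_mul_det, mul_one]

/-- Algebra maps out of `GL_q(2)` are determined by their restrictions to `M_q(2)`. -/
theorem algHom_ext_ofMq {B : Type*} [Ring B] [Algebra 𝕜 B] {f g : GLq q →ₐ[𝕜] B}
    (h : ∀ i j, f (ofMq q (Mq.T q i j)) = g (ofMq q (Mq.T q i j))) : f = g := by
  have hM : f.comp (ofMq q) = g.comp (ofMq q) := Mq.algHom_ext q h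
  -- The images of `θ` under `f` and `g` are both inverse to the common image of the determinant.
  refine algHom_ext q h (left_inv_eq_right_inv (a := f (ofMq q (Mq.det q))) ?_ ?_)
  · rw [← map_mul, θ_mul_det, map_one]
  · rw [show f (ofMq q (Mq.det q)) = g (ofMq q (Mq.det q)) from DFunLike.congr_fun hM _,
      ← map_mul, det_mul_θ, map_one]

theorem comul_ofMq (x : Mq q) : comul (R := 𝕜) (ofMq q x) =
    Algebra.TensorProduct.map (ofMq q) (ofMq q) (comul x) :=
  lift_ofMq q _ _ _ _ x

theorem comul_T (i j : Fin 2) : comul (R := 𝕜) (ofMq q (Mq.T q i j)) =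
    ∑ k, ofMq q (Mq.T q i k) ⊗ₜ[𝕜] ofMq q (Mq.T q k j) := by
  simp [comul_ofMq, Mq.comul_T]

theorem comul_θ : comul (R := 𝕜) (θ q) = θ q ⊗ₜ[𝕜] θ q :=
  lift_θ q _ _ _ _

theorem counit_ofMq (x : Mq q) : counit (R := 𝕜) (ofMq q x) = counit (R := 𝕜) x :=
  lift_ofMq q _ _ _ _ x

theorem counit_θ : counit (R := 𝕜) (θ q) = 1 :=
  lift_θ q _ _ _ _

/-- The canonical map `M_q(2) → GL_q(2)` as a map of bialgebras. -/
noncomputable def ofMqBialgHom : Mq q →ₐc[𝕜] GLq q :=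
  BialgHom.ofAlgHom (ofMq q) (AlgHom.ext fun x ↦ counit_ofMq q x)
    (AlgHom.ext fun x ↦ (comul_ofMq q x).symm)

/-! ### The derivation on `GL_q(2)` -/

/-- The map `x ↦ e(x) + ε D(x)` into the dual numbers given by a derivation `D`. -/
noncomputable def dualNumberHom {A : Type*} [Ring A] [Algebra 𝕜 A] (e : A →ₐ[𝕜] 𝕜)
    (D : A →ₗ[𝕜] 𝕜) (hD : IsPointDerivation e D) : A →ₐ[𝕜] DualNumber 𝕜 :=
  AlgHom.ofLinearMap
    { toFun := fun x ↦ TrivSqZeroExt.inl (e x) + TrivSqZeroExt.inr (D x)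
      map_add' := fun x y ↦ by ext <;> simp
      map_smul' := fun c x ↦ by ext <;> simp }
    (by
      have h : D 1 = 0 := by simpa using hD 1 1
      ext <;> simp [h])
    (fun x y ↦ by
      refine TrivSqZeroExt.ext (by simp) ?_
      simp [hD x y, mul_comm, add_comm])

theorem fst_dualNumberHom {A : Type*} [Ring A] [Algebra 𝕜 A] (e : A →ₐ[𝕜] 𝕜)
    (D : A →ₗ[𝕜] 𝕜) (hD : IsPointDerivation e D) (x : A) :
    (dualNumberHom e D hD x).fst = e x :=
  add_zero _

theorem snd_dualNumberHom {A : Type*} [Ring A] [Algebra 𝕜 A] (e : A →ₐ[𝕜] 𝕜)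
    (D : A →ₗ[𝕜] 𝕜) (hD : IsPointDerivation e D) (x : A) :
    (dualNumberHom e D hD x).snd = D x :=
  zero_add _

/-- The dual number valued character of `GL_q(2)` that encodes the counit and the derivation. -/
noncomputable def dualHom : GLq q →ₐ[𝕜] DualNumber 𝕜 :=
  lift q (dualNumberHom _ _ (Mq.der_isPointDerivation q))
    -- Since `ε(det) = 1` and `∂_q(det) = 2`, the determinant goes to `1 + 2ε`, whose inverse is `1
    -- - 2ε`. This is the origin of the value `-2`.
    (TrivSqZeroExt.inl 1 + TrivSqZeroExt.inr (-2)) (fun _ ↦ Commute.all _ _) (by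
      ext <;> simp [fst_dualNumberHom, snd_dualNumberHom, Mq.counit_det, Mq.der_det])

theorem fst_dualHom (x : GLq q) : (dualHom q x).fst = counit (R := 𝕜) x := by
  have h : (TrivSqZeroExt.fstHom 𝕜 𝕜 𝕜).comp (dualHom q) = Bialgebra.counitAlgHom 𝕜 (GLq q) := by
    refine algHom_ext_ofMq q fun i j ↦ ?_
    change (dualHom q (ofMq q (Mq.T q i j))).fst = counit (R := 𝕜) (ofMq q (Mq.T q i j))
    rw [dualHom, lift_ofMq, fst_dualNumberHom, counit_ofMq]
    rfl
  exact DFunLike.congr_fun h x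

/-- The derivation of `GL_q(2)` that extends `∂_q`. -/
noncomputable def der : GLq q →ₗ[𝕜] 𝕜 :=
  (TrivSqZeroExt.sndHom 𝕜 𝕜 : DualNumber 𝕜 →ₗ[𝕜] 𝕜) ∘ₗ (dualHom q).toLinearMap

theorem der_isPointDerivation : IsPointDerivation (Bialgebra.counitAlgHom 𝕜 (GLq q)) (der q) := by
  intro x y
  change (dualHom q (x * y)).snd = (dualHom q x).snd * counit y + counit x * (dualHom q y).snd
  rw [map_mul, TrivSqZeroExt.snd_mul, fst_dualHom, fst_dualHom, add_comm]
  simp [mul_comm]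

theorem der_ofMq (x : Mq q) : der q (ofMq q x) = Mq.der q x := by
  change (dualHom q (ofMq q x)).snd = _
  rw [dualHom, lift_ofMq, snd_dualNumberHom]

theorem der_θ : der q (θ q) = -2 := by
  change (dualHom q (θ q)).snd = _
  rw [dualHom, lift_θ]
  simp

theorem isCentral_der : ConvolutionForm.IsCentral (der q) := by
  refine ConvolutionForm.isCentral_of_adjoin (der_isPointDerivation q) (adjoin_T_θ q) ?_
  rintro _ (rfl | ⟨⟨i, j⟩, rfl⟩)
  · simp [comul_θ]
  · fin_cases i <;> fin_cases j <;> simp [comul_T, der_ofMq, Mq.der_T]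

theorem tensorForm_der_ne_zero : tensorForm (der q) (der q) ≠ 0 := by
  intro h
  have := LinearMap.congr_fun h (ofMq q (Mq.α q) ⊗ₜ ofMq q (Mq.α q))
  simp [tensorForm, der_ofMq, Mq.der_T] at this

theorem counit_mk (p : Polynomial (Mq q)) : counit (R := 𝕜) (mk q p) = polyCounit q p :=
  lift_mk q _ _ _ _ p

theorem isHatDer_der : IsHatDer q (der q ∘ₗ (mk q).toLinearMap) where
  derivation x y := by
    have h := der_isPointDerivation q (mk q x) (mk q y)
    rw [← map_mul, Bialgebra.counitAlgHom_apply, Bialgebra.counitAlgHom_apply, counit_mk,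
      counit_mk] at h
    exact h
  restrict ξ := der_ofMq q ξ
  map_θ := der_θ q

variable {q} in
theorem IsHatDer.ext {D D' : Polynomial (Mq q) →ₗ[𝕜] 𝕜} (h : IsHatDer q D)
    (h' : IsHatDer q D') : D = D' := by
  refine LinearMap.ext fun p ↦ ?_
  have hX (n : ℕ) : D (Polynomial.X ^ n) = D' (Polynomial.X ^ n) := by
    induction n with
    | zero =>
      rw [pow_zero, ← Polynomial.C_1, h.restrict, h'.restrict]
    | succ n ih => rw [pow_succ, h.derivation, h'.derivation, ih, h.map_θ, h'.map_θ]
  induction p using Polynomial.induction_on with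
  | C a => rw [h.restrict, h'.restrict]
  | add a b ha hb => rw [map_add, map_add, ha, hb]
  | monomial n a _ => rw [h.derivation, h'.derivation, hX, h.restrict, h'.restrict]

end GLq

/-! ### Checking intertwiners and antipodes on generators. -/

namespace ConvolutionForm

section Intertwine

variable {𝕜 : Type*} [Field 𝕜] {A B : Type*} [Ring A] [Algebra 𝕜 A] [Ring B] [Algebra 𝕜 B]

/-- The elements `a` satisfying the relation form a subalgebra. The braiding, the exchange relation
and the commutation axiom are all reduced to generators this way. -/
theorem intertwine_of_adjoin (φ ψ : A →ₐ[𝕜] B) (x : B) {s : Set A}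
    (hs : Algebra.adjoin 𝕜 s = ⊤) (h : ∀ a ∈ s, x * φ a = ψ a * x) (a : A) :
    x * φ a = ψ a * x := by
  have ha : a ∈ Algebra.adjoin 𝕜 s := hs ▸ Algebra.mem_top
  induction ha using Algebra.adjoin_induction with
  | mem a ha => exact h a ha
  | algebraMap r => rw [AlgHom.commutes, AlgHom.commutes, Algebra.commutes]
  | add a b _ _ ha hb => rw [map_add, map_add, mul_add, add_mul, ha, hb]
  | mul a b _ _ ha hb => rw [map_mul, map_mul, ← mul_assoc, ha, mul_assoc, hb, mul_assoc]

end Intertwine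

section Antipode

variable {𝕜 : Type*} [Field 𝕜] {H A : Type*} [Ring H] [Bialgebra 𝕜 H] [Ring A] [Algebra 𝕜 A]

/-- The linear map underlying an anti-homomorphism. -/
noncomputable def unopMap (g : H →ₐ[𝕜] Aᵐᵒᵖ) : H →ₗ[𝕜] A :=
  (MulOpposite.opLinearEquiv 𝕜).symm.toLinearMap ∘ₗ g.toLinearMap

@[simp]
theorem unopMap_apply (g : H →ₐ[𝕜] Aᵐᵒᵖ) (x : H) : unopMap g x = (g x).unop := rfl

/-- On a product the sum is `f(x₁) f(y₁) g(y₂) g(x₂)`, with `g` anti-multiplicative. The inner pair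
collapses to the scalar `ε(y)` and the outer pair to `ε(x)`. -/
theorem mul_unopMap_eq_one (f : H →ₐ[𝕜] A) (g : H →ₐ[𝕜] Aᵐᵒᵖ) {s : Set H}
    (hs : Algebra.adjoin 𝕜 s = ⊤)
    (h : ∀ x ∈ s, (toConv f.toLinearMap * toConv (unopMap g)) x =
      algebraMap 𝕜 A (counit (R := 𝕜) x)) :
    toConv f.toLinearMap * toConv (unopMap g) = 1 := by
  ext x
  change (toConv f.toLinearMap * toConv (unopMap g)) x = algebraMap 𝕜 A (counit (R := 𝕜) x)
  have hx : x ∈ Algebra.adjoin 𝕜 s := hs ▸ Algebra.mem_top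
  induction hx using Algebra.adjoin_induction with
  | mem x hx => exact h x hx
  | algebraMap r => simp [Algebra.algebraMap_eq_smul_one, Algebra.TensorProduct.one_def]
  | add x y _ _ hx hy => rw [map_add, hx, hy, map_add, map_add]
  | mul x y _ _ hx hy =>
    rw [((ℛ 𝕜 x).mul (ℛ 𝕜 y)).convMul_apply]
    rw [(ℛ 𝕜 x).convMul_apply] at hx
    rw [(ℛ 𝕜 y).convMul_apply] at hy
    simp only [Coalgebra.Repr.mul_index, Coalgebra.Repr.mul_left, Coalgebra.Repr.mul_right,
      Finset.sum_product, AlgHom.toLinearMap_apply, unopMap_apply, map_mul,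
      MulOpposite.unop_mul] at hx hy ⊢
    have key : ∀ a b : A, ∑ i ∈ (ℛ 𝕜 y).index, a * f ((ℛ 𝕜 y).left i) *
        ((g ((ℛ 𝕜 y).right i)).unop * b) = algebraMap 𝕜 A (counit (R := 𝕜) y) * (a * b) := by
      intro a b
      rw [← mul_assoc, Algebra.commutes, ← hy]
      simp only [Finset.mul_sum, Finset.sum_mul, mul_assoc]
    simp only [key, ← Finset.mul_sum, hx, Bialgebra.counit_mul, map_mul]
    exact Algebra.commutes _ _

theorem unopMap_mul_eq_one (f : H →ₐ[𝕜] A) (g : H →ₐ[𝕜] Aᵐᵒᵖ) {s : Set H}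
    (hs : Algebra.adjoin 𝕜 s = ⊤)
    (h : ∀ x ∈ s, (toConv (unopMap g) * toConv f.toLinearMap) x =
      algebraMap 𝕜 A (counit (R := 𝕜) x)) :
    toConv (unopMap g) * toConv f.toLinearMap = 1 := by
  ext x
  change (toConv (unopMap g) * toConv f.toLinearMap) x = algebraMap 𝕜 A (counit (R := 𝕜) x)
  have hx : x ∈ Algebra.adjoin 𝕜 s := hs ▸ Algebra.mem_top
  induction hx using Algebra.adjoin_induction with
  | mem x hx => exact h x hx
  | algebraMap r => simp [Algebra.algebraMap_eq_smul_one, Algebra.TensorProduct.one_def]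
  | add x y _ _ hx hy => rw [map_add, hx, hy, map_add, map_add]
  | mul x y _ _ hx hy =>
    rw [((ℛ 𝕜 x).mul (ℛ 𝕜 y)).convMul_apply]
    rw [(ℛ 𝕜 x).convMul_apply] at hx
    rw [(ℛ 𝕜 y).convMul_apply] at hy
    simp only [Coalgebra.Repr.mul_index, Coalgebra.Repr.mul_left, Coalgebra.Repr.mul_right,
      Finset.sum_product_right, AlgHom.toLinearMap_apply, unopMap_apply, map_mul,
      MulOpposite.unop_mul] at hx hy ⊢
    have key : ∀ a b : A, ∑ i ∈ (ℛ 𝕜 x).index, a * (g ((ℛ 𝕜 x).left i)).unop *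
        (f ((ℛ 𝕜 x).right i) * b) = algebraMap 𝕜 A (counit (R := 𝕜) x) * (a * b) := by
      intro a b
      rw [← mul_assoc, Algebra.commutes, ← hx]
      simp only [Finset.mul_sum, Finset.sum_mul, mul_assoc]
    simp only [key, ← Finset.mul_sum, hy, Bialgebra.counit_mul, map_mul]

end Antipode

section ComulLift

variable {𝕜 : Type*} [Field 𝕜] {H A : Type*} [Ring H] [Bialgebra 𝕜 H] [Ring A] [Algebra 𝕜 A]

/-- The algebra map `a ↦ f(a₁) g(a₂)` for algebra maps `f` and `g` with commuting images. -/
noncomputable def comulLift (f g : H →ₐ[𝕜] A) (h : ∀ x y, Commute (f x) (g y)) : H →ₐ[𝕜] A :=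
  (Algebra.TensorProduct.lift f g h).comp (Bialgebra.comulAlgHom 𝕜 H)

theorem comulLift_apply (f g : H →ₐ[𝕜] A) (h : ∀ x y, Commute (f x) (g y)) {ι : Type*} {a : H}
    (r : Coalgebra.Repr 𝕜 a ι) :
    comulLift f g h a = ∑ i ∈ r.index, f (r.left i) * g (r.right i) := by
  simp [comulLift, ← r.eq]

theorem comulLift_grouplike (f g : H →ₐ[𝕜] A) (h : ∀ x y, Commute (f x) (g y)) {a : H}
    (ha : comul (R := 𝕜) a = a ⊗ₜ a) : comulLift f g h a = f a * g a := by
  simp [comulLift, ha]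

end ComulLift

/-! ### Forms built from algebra maps into the dual: invertibility and multiplicativity. -/

section Form

variable {𝕜 : Type*} [Field 𝕜] {H K : Type*} [Ring H] [Bialgebra 𝕜 H] [Ring K] [Bialgebra 𝕜 K]

/-- The form `a ⊗ b ↦ ψ(a)(b)`. -/
noncomputable def form (ψ : H →ₗ[𝕜] WithConv (K →ₗ[𝕜] 𝕜)) : H ⊗[𝕜] K →ₗ[𝕜] 𝕜 :=
  TensorProduct.lift ((WithConv.linearEquiv 𝕜 (K →ₗ[𝕜] 𝕜)).toLinearMap ∘ₗ ψ)

@[simp]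
theorem form_tmul (ψ : H →ₗ[𝕜] WithConv (K →ₗ[𝕜] 𝕜)) (a : H) (b : K) :
    form ψ (a ⊗ₜ b) = ψ a b := rfl

theorem form_one : toConv (form (1 : WithConv (H →ₗ[𝕜] WithConv (K →ₗ[𝕜] 𝕜))).ofConv) = 1 := by
  ext a b
  simp [mul_comm]

theorem form_mul (f g : WithConv (H →ₗ[𝕜] WithConv (K →ₗ[𝕜] 𝕜))) :
    toConv (form (f * g).ofConv) = toConv (form f.ofConv) * toConv (form g.ofConv) := by
  refine WithConv.ext (TensorProduct.ext' fun a b ↦ ?_)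
  rw [((ℛ 𝕜 a).tmul (ℛ 𝕜 b)).convMul_apply]
  change (f * g) a b = _
  rw [(ℛ 𝕜 a).convMul_apply, ofConv_sum, LinearMap.sum_apply]
  simp [Finset.sum_product, (ℛ 𝕜 b).convMul_apply]

/-- Postcomposition with an algebra map respects convolution, so the inverse of the identity, the
antipode, is carried to a convolution inverse of `ψ`. -/
theorem algHom_comp_mul_comp {A : Type*} [Ring A] [Algebra 𝕜 A] (ψ : H →ₐ[𝕜] A) {σ τ : H →ₗ[𝕜] H}
    (h : toConv σ * toConv τ = 1) :
    toConv (ψ.toLinearMap ∘ₗ σ) * toConv (ψ.toLinearMap ∘ₗ τ) = 1 := by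
  have h' := map_mul (postcomp H ψ) (toConv σ) (toConv τ)
  rw [h, map_one] at h'
  exact h'.symm

/-- An algebra map `ψ` from a Hopf algebra with antipode `σ` into the convolution algebra gives a
convolution invertible form. -/
noncomputable def formUnit (ψ : H →ₐ[𝕜] WithConv (K →ₗ[𝕜] 𝕜)) (σ : H →ₗ[𝕜] H)
    (h₁ : toConv LinearMap.id * toConv σ = 1) (h₂ : toConv σ * toConv LinearMap.id = 1) :
    (WithConv (H ⊗[𝕜] K →ₗ[𝕜] 𝕜))ˣ where
  val := toConv (form ψ.toLinearMap)
  inv := toConv (form (ψ.toLinearMap ∘ₗ σ))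
  val_inv := by
    refine (form_mul (toConv ψ.toLinearMap) (toConv (ψ.toLinearMap ∘ₗ σ))).symm.trans ?_
    rw [← form_one, ← algHom_comp_mul_comp ψ h₁]
    rfl
  inv_val := by
    refine (form_mul (toConv (ψ.toLinearMap ∘ₗ σ)) (toConv ψ.toLinearMap)).symm.trans ?_
    rw [← form_one, ← algHom_comp_mul_comp ψ h₂]
    rfl

theorem snd_mul_fst_apply (f g : WithConv (K →ₗ[𝕜] 𝕜)) (b c : K) :
    (precomp 𝕜 (sndProj 𝕜 K K).toCoalgHom f * precomp 𝕜 (fstProj 𝕜 K K).toCoalgHom g)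
      (b ⊗ₜ c) = f c * g b := by
  rw [((ℛ 𝕜 b).tmul (ℛ 𝕜 c)).convMul_apply]
  trans f (∑ i ∈ (ℛ 𝕜 c).index, counit (R := 𝕜) ((ℛ 𝕜 c).right i) • (ℛ 𝕜 c).left i) *
    g (∑ i ∈ (ℛ 𝕜 b).index, counit (R := 𝕜) ((ℛ 𝕜 b).left i) • (ℛ 𝕜 b).right i)
  swap
  · rw [sum_counit_right_smul, Coalgebra.sum_counit_smul]
  simp only [Coalgebra.Repr.tmul_index, Coalgebra.Repr.tmul_left, Coalgebra.Repr.tmul_right,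
    Finset.sum_product_right, precomp_apply, map_sum, map_smul, Finset.sum_mul_sum]
  refine Finset.sum_congr rfl fun i _ ↦ Finset.sum_congr rfl fun j _ ↦ ?_
  change f (counit (R := 𝕜) ((ℛ 𝕜 b).left j) • (ℛ 𝕜 c).left i) *
    g (counit (R := 𝕜) ((ℛ 𝕜 c).right i) • (ℛ 𝕜 b).right j) = _
  simp only [map_smul, smul_eq_mul]
  ring

theorem fst_mul_snd_apply (f g : WithConv (K →ₗ[𝕜] 𝕜)) (b c : K) :
    (precomp 𝕜 (fstProj 𝕜 K K).toCoalgHom g * precomp 𝕜 (sndProj 𝕜 K K).toCoalgHom f)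
      (b ⊗ₜ c) = g b * f c := by
  rw [((ℛ 𝕜 b).tmul (ℛ 𝕜 c)).convMul_apply]
  trans g (∑ i ∈ (ℛ 𝕜 b).index, counit (R := 𝕜) ((ℛ 𝕜 b).right i) • (ℛ 𝕜 b).left i) *
    f (∑ i ∈ (ℛ 𝕜 c).index, counit (R := 𝕜) ((ℛ 𝕜 c).left i) • (ℛ 𝕜 c).right i)
  swap
  · rw [sum_counit_right_smul, Coalgebra.sum_counit_smul]
  simp only [Coalgebra.Repr.tmul_index, Coalgebra.Repr.tmul_left, Coalgebra.Repr.tmul_right,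
    Finset.sum_product, precomp_apply, map_sum, map_smul, Finset.sum_mul_sum]
  refine Finset.sum_congr rfl fun i _ ↦ Finset.sum_congr rfl fun j _ ↦ ?_
  change g (counit (R := 𝕜) ((ℛ 𝕜 c).left j) • (ℛ 𝕜 b).left i) *
    f (counit (R := 𝕜) ((ℛ 𝕜 b).right i) • (ℛ 𝕜 c).right j) = _
  simp only [map_smul, smul_eq_mul]
  ring

/-- Functionals of different tensor factors commute. This is what makes `splitMul` an algebra map.
-/
theorem commute_snd_fst (f g : WithConv (K →ₗ[𝕜] 𝕜)) :
    Commute (precomp 𝕜 (sndProj 𝕜 K K).toCoalgHom f) (precomp 𝕜 (fstProj 𝕜 K K).toCoalgHom g) := by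
  refine WithConv.ext (TensorProduct.ext' fun b c ↦ ?_)
  exact (snd_mul_fst_apply f g b c).trans
    ((mul_comm _ _).trans (fst_mul_snd_apply f g b c).symm)

/-- For `ψ : H → K*`, the map sending `a` to `b ⊗ c ↦ ψ(a)(b c)`. -/
noncomputable def onMul (ψ : H →ₐ[𝕜] WithConv (K →ₗ[𝕜] 𝕜)) :
    H →ₐ[𝕜] WithConv (K ⊗[𝕜] K →ₗ[𝕜] 𝕜) :=
  (precomp 𝕜 (Bialgebra.mulCoalgHom 𝕜 K)).comp ψ

/-- For `ψ : H → K*`, the map sending `a` to `b ⊗ c ↦ ψ(a₁)(c) ψ(a₂)(b)`. -/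
noncomputable def splitMul (ψ : H →ₐ[𝕜] WithConv (K →ₗ[𝕜] 𝕜)) :
    H →ₐ[𝕜] WithConv (K ⊗[𝕜] K →ₗ[𝕜] 𝕜) :=
  comulLift ((precomp 𝕜 (sndProj 𝕜 K K).toCoalgHom).comp ψ)
    ((precomp 𝕜 (fstProj 𝕜 K K).toCoalgHom).comp ψ) fun _ _ ↦ commute_snd_fst _ _

theorem onMul_apply (ψ : H →ₐ[𝕜] WithConv (K →ₗ[𝕜] 𝕜)) (a : H) (b c : K) :
    onMul ψ a (b ⊗ₜ c) = ψ a (b * c) := rfl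

theorem splitMul_apply (ψ : H →ₐ[𝕜] WithConv (K →ₗ[𝕜] 𝕜)) {ι : Type*} {a : H}
    (r : Coalgebra.Repr 𝕜 a ι) (b c : K) :
    splitMul ψ a (b ⊗ₜ c) = ∑ i ∈ r.index, ψ (r.left i) c * ψ (r.right i) b := by
  have h : splitMul ψ a = ∑ i ∈ r.index, precomp 𝕜 (sndProj 𝕜 K K).toCoalgHom (ψ (r.left i)) *
      precomp 𝕜 (fstProj 𝕜 K K).toCoalgHom (ψ (r.right i)) := comulLift_apply _ _ _ r
  rw [h, ofConv_sum, LinearMap.sum_apply]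
  refine Finset.sum_congr rfl fun i _ ↦ ?_
  exact snd_mul_fst_apply _ _ b c

/-- The hypothesis equates two algebra maps out of `H`, so the axiom in the right argument can be
verified on generators of the left one. -/
theorem rightConv_form_mul {ψ : H →ₐ[𝕜] WithConv (K →ₗ[𝕜] 𝕜)} (h : onMul ψ = splitMul ψ)
    (b c : K) : rightConv (form ψ.toLinearMap) (b * c) =
      rightConv (form ψ.toLinearMap) c * rightConv (form ψ.toLinearMap) b := by
  ext a
  rw [(ℛ 𝕜 a).convMul_apply]
  exact (congrArg (fun φ ↦ φ a (b ⊗ₜ c)) h).trans (splitMul_apply ψ (ℛ 𝕜 a) b c)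

end Form

/-! ### The commutation axiom, reduced to generators in both arguments. -/

section Braided

variable {𝕜 : Type*} [Field 𝕜] {K : Type*} [Ring K] [Bialgebra 𝕜 K]

variable (𝕜 K) in
/-- Scalar valued functionals, viewed in the convolution algebra of `K`-valued maps. -/
noncomputable def scalarMaps : WithConv (K →ₗ[𝕜] 𝕜) →ₐ[𝕜] WithConv (K →ₗ[𝕜] K) :=
  postcomp K (Algebra.ofId 𝕜 K)

theorem commute_scalarMaps_const (f : WithConv (K →ₗ[𝕜] 𝕜)) (a : K) :
    Commute (scalarMaps 𝕜 K f) (const 𝕜 K K a) := by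
  ext x
  exact (mul_constMap_apply (scalarMaps 𝕜 K f) a x).trans
    ((Algebra.commutes _ _).trans (constMap_mul_apply (scalarMaps 𝕜 K f) a x).symm)

/-- The map sending `a` to `b ↦ ψ(a₁)(b) a₂`. -/
noncomputable def actLeft (ψ : K →ₐ[𝕜] WithConv (K →ₗ[𝕜] 𝕜)) :
    K →ₐ[𝕜] WithConv (K →ₗ[𝕜] K) :=
  comulLift ((scalarMaps 𝕜 K).comp ψ) (const 𝕜 K K) fun _ _ ↦ commute_scalarMaps_const _ _

/-- The map sending `a` to `b ↦ a₁ ψ(a₂)(b)`. -/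
noncomputable def actRight (ψ : K →ₐ[𝕜] WithConv (K →ₗ[𝕜] 𝕜)) :
    K →ₐ[𝕜] WithConv (K →ₗ[𝕜] K) :=
  comulLift (const 𝕜 K K) ((scalarMaps 𝕜 K).comp ψ)
    fun _ _ ↦ (commute_scalarMaps_const _ _).symm

theorem actLeft_apply (ψ : K →ₐ[𝕜] WithConv (K →ₗ[𝕜] 𝕜)) {ι : Type*} {a : K}
    (r : Coalgebra.Repr 𝕜 a ι) (b : K) :
    actLeft ψ a b = ∑ i ∈ r.index, ψ (r.left i) b • r.right i := by
  have h : actLeft ψ a = ∑ i ∈ r.index, scalarMaps 𝕜 K (ψ (r.left i)) *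
      const 𝕜 K K (r.right i) := comulLift_apply _ _ _ r
  rw [h, ofConv_sum, LinearMap.sum_apply]
  refine Finset.sum_congr rfl fun i _ ↦ ?_
  rw [Algebra.smul_def]
  exact mul_constMap_apply _ _ b

theorem actRight_apply (ψ : K →ₐ[𝕜] WithConv (K →ₗ[𝕜] 𝕜)) {ι : Type*} {a : K}
    (r : Coalgebra.Repr 𝕜 a ι) (b : K) :
    actRight ψ a b = ∑ i ∈ r.index, ψ (r.right i) b • r.left i := by
  have h : actRight ψ a = ∑ i ∈ r.index, const 𝕜 K K (r.left i) *
      scalarMaps 𝕜 K (ψ (r.right i)) := comulLift_apply _ _ _ r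
  rw [h, ofConv_sum, LinearMap.sum_apply]
  refine Finset.sum_congr rfl fun i _ ↦ ?_
  rw [Algebra.smul_def, Algebra.commutes]
  exact constMap_mul_apply _ _ b

/-- Evaluated at `b`, the hypothesis is `ψ(a₁)(b₁) a₂ b₂ = b₁ a₁ ψ(a₂)(b₂)`. It says that the
identity map intertwines two algebra maps in `a`, so it may be tested on generators `a`. -/
theorem mul_comm_of_actLeft {ψ : K →ₐ[𝕜] WithConv (K →ₗ[𝕜] 𝕜)}
    (h : ∀ a, actLeft ψ a * toConv LinearMap.id = toConv LinearMap.id * actRight ψ a) :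
    unitComp (form ψ.toLinearMap) * toConv (LinearMap.mul' 𝕜 K) =
    toConv (LinearMap.mul' 𝕜 K ∘ₗ (TensorProduct.comm 𝕜 K K).toLinearMap) *
      unitComp (form ψ.toLinearMap) := by
  refine WithConv.ext (TensorProduct.ext' fun a b ↦ ?_)
  have hab := congrArg (fun f ↦ f.ofConv b) (h a)
  simp only [(ℛ 𝕜 b).convMul_apply, actLeft_apply ψ (ℛ 𝕜 a), actRight_apply ψ (ℛ 𝕜 a)] at hab
  rw [((ℛ 𝕜 a).tmul (ℛ 𝕜 b)).convMul_apply, ((ℛ 𝕜 a).tmul (ℛ 𝕜 b)).convMul_apply]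
  simpa [Finset.sum_product_right, unitComp, Finset.sum_mul, Finset.mul_sum, Algebra.smul_def,
    Algebra.commutes, mul_assoc] using hab

theorem actLeft_mul_id_of_grouplike {ψ : K →ₐ[𝕜] WithConv (K →ₗ[𝕜] 𝕜)} {g : K}
    (hg : comul (R := 𝕜) g = g ⊗ₜ g) (hψ : ψ g = 1) (hc : ∀ x, Commute x g) :
    actLeft ψ g * toConv LinearMap.id = toConv LinearMap.id * actRight ψ g := by
  have hl : actLeft ψ g = const 𝕜 K K g := by
    have h : actLeft ψ g = scalarMaps 𝕜 K (ψ g) * const 𝕜 K K g := comulLift_grouplike _ _ _ hg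
    rw [h, hψ, map_one, one_mul]
  have hr : actRight ψ g = const 𝕜 K K g := by
    have h : actRight ψ g = const 𝕜 K K g * scalarMaps 𝕜 K (ψ g) := comulLift_grouplike _ _ _ hg
    rw [h, hψ, map_one, mul_one]
  rw [hl, hr, const_eq]
  refine WithConv.ext (LinearMap.ext fun x ↦ ?_)
  rw [constMap_mul_apply, mul_constMap_apply]
  exact (hc x).symm

section Matrix

variable {n : Type*} [Fintype n] [DecidableEq n]

/-- Scalar matrices commute with matrices over the base field. -/
theorem commute_mapMatrix_scalar (M : Matrix n n 𝕜) (x : K) :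
    Commute ((Algebra.ofId 𝕜 K).mapMatrix M) (Matrix.scalarAlgHom n 𝕜 x) := by
  ext i j
  simp [Algebra.ofId_apply, Algebra.commutes]

/-- The map `b ↦ r(b₁) b₂`. -/
noncomputable def matLeft (r : K →ₐ[𝕜] Matrix n n 𝕜) : K →ₐ[𝕜] Matrix n n K :=
  comulLift ((Algebra.ofId 𝕜 K).mapMatrix.comp r) (Matrix.scalarAlgHom n 𝕜)
    fun _ _ ↦ commute_mapMatrix_scalar _ _

/-- The map `b ↦ b₁ r(b₂)`. -/
noncomputable def matRight (r : K →ₐ[𝕜] Matrix n n 𝕜) : K →ₐ[𝕜] Matrix n n K :=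
  comulLift (Matrix.scalarAlgHom n 𝕜) ((Algebra.ofId 𝕜 K).mapMatrix.comp r)
    fun _ _ ↦ (commute_mapMatrix_scalar _ _).symm

theorem matLeft_apply (r : K →ₐ[𝕜] Matrix n n 𝕜) {ι : Type*} {b : K}
    (rb : Coalgebra.Repr 𝕜 b ι) (i j : n) :
    matLeft r b i j = ∑ k ∈ rb.index, r (rb.left k) i j • rb.right k := by
  have h : matLeft r b = ∑ k ∈ rb.index, (Algebra.ofId 𝕜 K).mapMatrix (r (rb.left k)) *
      Matrix.scalarAlgHom n 𝕜 (rb.right k) := comulLift_apply _ _ _ rb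
  rw [h, Matrix.sum_apply]
  refine Finset.sum_congr rfl fun k _ ↦ ?_
  simp [Algebra.smul_def, Algebra.ofId_apply]

theorem matRight_apply (r : K →ₐ[𝕜] Matrix n n 𝕜) {ι : Type*} {b : K}
    (rb : Coalgebra.Repr 𝕜 b ι) (i j : n) :
    matRight r b i j = ∑ k ∈ rb.index, r (rb.right k) i j • rb.left k := by
  have h : matRight r b = ∑ k ∈ rb.index, Matrix.scalarAlgHom n 𝕜 (rb.left k) *
      (Algebra.ofId 𝕜 K).mapMatrix (r (rb.right k)) := comulLift_apply _ _ _ rb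
  rw [h, Matrix.sum_apply]
  refine Finset.sum_congr rfl fun k _ ↦ ?_
  simp [Algebra.smul_def, Algebra.ofId_apply, Algebra.commutes]

/-- With `a` an entry of `t`, the commutation axiom becomes an intertwining of the algebra maps
`matLeft r` and `matRight r` in `b`, so generators `b` suffice as well. The transpose arises because
`b ↦ ψ(t i j)(b)` reverses products. -/
theorem actLeft_mul_id_of_matrix {ψ : K →ₐ[𝕜] WithConv (K →ₗ[𝕜] 𝕜)} {t : Matrix n n K}
    (ht : ∀ i j, comul (R := 𝕜) (t i j) = ∑ k, t i k ⊗ₜ t k j) {r : K →ₐ[𝕜] Matrix n n 𝕜}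
    (hr : ∀ i j b, ψ (t i j) b = r b j i)
    (h : ∀ b, t.transpose * matLeft r b = matRight r b * t.transpose) (i j : n) :
    actLeft ψ (t i j) * toConv LinearMap.id = toConv LinearMap.id * actRight ψ (t i j) := by
  refine WithConv.ext (LinearMap.ext fun b ↦ ?_)
  have hb := congrFun (congrFun (h b) j) i
  let R : Coalgebra.Repr 𝕜 (t i j) n :=
    { index := Finset.univ, left := fun k ↦ t i k, right := fun k ↦ t k j, eq := (ht i j).symm }
  rw [(ℛ 𝕜 b).convMul_apply, (ℛ 𝕜 b).convMul_apply]
  simp only [Matrix.mul_apply, Matrix.transpose_apply, matLeft_apply r (ℛ 𝕜 b),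
    matRight_apply r (ℛ 𝕜 b), Finset.mul_sum, Finset.sum_mul] at hb
  simp only [actLeft_apply ψ R, actRight_apply ψ R, R, hr, Finset.mul_sum, Finset.sum_mul]
  rw [Finset.sum_comm]
  trans ∑ x, ∑ k ∈ (ℛ 𝕜 b).index, t x j * r ((ℛ 𝕜 b).left k) x i • (ℛ 𝕜 b).right k
  · simp
  · rw [hb, Finset.sum_comm]
    simp

end Matrix

end Braided

end ConvolutionForm

open ConvolutionForm

namespace GLq

variable {𝕜 : Type*} [Field 𝕜] (q : 𝕜ˣ)

/-! ### The antipode of `GL_q(2)` -/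

/-- The quantum adjugate of the matrix of generators. -/
noncomputable def adj : Matrix (Fin 2) (Fin 2) (Mq q) :=
  !![Mq.δ q, -((q : 𝕜) • Mq.β q); -((q : 𝕜)⁻¹ • Mq.γ q), Mq.α q]

/-- The linear map `x ↦ θ² x` into the opposite algebra. -/
noncomputable def opSqMul : Mq q →ₗ[𝕜] (GLq q)ᵐᵒᵖ :=
  (MulOpposite.opLinearEquiv 𝕜).toLinearMap ∘ₗ
    LinearMap.mulLeft 𝕜 (θ q * θ q) ∘ₗ (ofMq q).toLinearMap

theorem opSqMul_apply (x : Mq q) :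
    opSqMul q x = MulOpposite.op (θ q * θ q * ofMq q x) := rfl

/-- Collecting the two central factors `θ` reduces every quadratic relation for the antipode to an
identity inside `M_q(2)`. -/
theorem op_θ_mul_mul_op (x y : Mq q) :
    MulOpposite.op (θ q * ofMq q x) * MulOpposite.op (θ q * ofMq q y) = opSqMul q (y * x) := by
  rw [opSqMul_apply, ← MulOpposite.op_mul, map_mul, mul_assoc, ← mul_assoc (ofMq q y),
    (ofMq_comm q y).eq]
  simp only [mul_assoc]

/-- The antipode of `GL_q(2)` on `M_q(2)`. -/
noncomputable def antipodeMq : Mq q →ₐ[𝕜] (GLq q)ᵐᵒᵖ :=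
  Mq.lift q (fun i j ↦ MulOpposite.op (θ q * ofMq q (adj q i j))) (by
    have hq : (q : 𝕜) ≠ 0 := q.ne_zero
    intro x y h
    cases h <;>
    · simp only [map_mul, map_smul, map_sub, FreeAlgebra.lift_ι_apply, op_θ_mul_mul_op]
      try simp only [← map_smul, ← map_sub]
      refine congrArg (opSqMul q) ?_
      simp [adj, Mq.ba, Mq.ca, Mq.db, Mq.dc, Mq.cb, Mq.da, smul_smul, hq])

theorem antipodeMq_T (i j : Fin 2) :
    antipodeMq q (Mq.T q i j) = MulOpposite.op (θ q * ofMq q (adj q i j)) :=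
  Mq.lift_T q _ _ i j

theorem commute_op_det (x : (GLq q)ᵐᵒᵖ) : Commute x (MulOpposite.op (ofMq q (Mq.det q))) :=
  MulOpposite.unop_injective (commute_det q x.unop).symm.eq

/-- The antipode of `GL_q(2)`. -/
noncomputable def antipode : GLq q →ₐ[𝕜] (GLq q)ᵐᵒᵖ :=
  lift q (antipodeMq q) (MulOpposite.op (ofMq q (Mq.det q)))
    (fun _ ↦ commute_op_det q _) (by
      have hq : (q : 𝕜) ≠ 0 := q.ne_zero
      -- The adjugate entries, multiplied in reverse order, have the same quantum determinant, so
      -- `det` is sent to `θ² det = θ`, the inverse of the image of `θ`.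
      have h : antipodeMq q (Mq.det q) = MulOpposite.op (θ q * θ q * ofMq q (Mq.det q)) := by
        rw [Mq.det]
        rw [map_sub, map_smul, map_mul, map_mul]
        simp only [antipodeMq_T, op_θ_mul_mul_op]
        simp only [← map_smul, ← map_sub]
        refine congrArg (opSqMul q) ?_
        simp [adj, Mq.cb, smul_smul, hq]
      rw [h, ← MulOpposite.op_mul, mul_assoc, mul_assoc, ← mul_assoc (θ q) (ofMq q _), θ_mul_det,
        one_mul, θ_mul_det]
      rfl)

theorem unop_antipode_T (i j : Fin 2) :
    (antipode q (ofMq q (Mq.T q i j))).unop = θ q * ofMq q (adj q i j) := by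
  rw [antipode, lift_ofMq, antipodeMq_T, MulOpposite.unop_op]

theorem unop_antipode_θ : (antipode q (θ q)).unop = ofMq q (Mq.det q) := by
  rw [antipode, lift_θ, MulOpposite.unop_op]

theorem id_mul_antipode :
    toConv (LinearMap.id : GLq q →ₗ[𝕜] GLq q) * toConv (unopMap (antipode q)) = 1 := by
  have hq : (q : 𝕜) ≠ 0 := q.ne_zero
  refine mul_unopMap_eq_one (AlgHom.id 𝕜 (GLq q)) (antipode q) (adjoin_T_θ q) ?_
  rintro _ (rfl | ⟨⟨i, j⟩, rfl⟩)
  · simp [comul_θ, counit_θ, unop_antipode_θ, θ_mul_det]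
  · have h : ∑ k, Mq.T q i k * adj q k j = if i = j then Mq.det q else 0 := by
      fin_cases i <;> fin_cases j <;>
        simp [adj, Mq.det, Mq.ba, Mq.da, Mq.dc, Mq.cb, smul_smul, hq, sub_smul] <;> abel
    have h' : ∑ k, ofMq q (Mq.T q i k) * (θ q * ofMq q (adj q k j)) =
        θ q * ofMq q (∑ k, Mq.T q i k * adj q k j) := by
      simp only [map_sum, map_mul, Finset.mul_sum]
      refine Finset.sum_congr rfl fun k _ ↦ ?_
      rw [← mul_assoc, (ofMq_comm q _).eq, mul_assoc]
    have h'' : (toConv (AlgHom.id 𝕜 (GLq q)).toLinearMap * toConv (unopMap (antipode q)))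
        (ofMq q (Mq.T q i j)) = ∑ k, ofMq q (Mq.T q i k) * (θ q * ofMq q (adj q k j)) := by
      simp only [LinearMap.convMul_apply, comul_T, map_sum, TensorProduct.map_tmul,
        LinearMap.mul'_apply]
      simp [unop_antipode_T]
    rw [h'', h', h, counit_ofMq, Mq.counit_T]
    split_ifs <;> simp [θ_mul_det]

theorem antipode_mul_id :
    toConv (unopMap (antipode q)) * toConv (LinearMap.id : GLq q →ₗ[𝕜] GLq q) = 1 := by
  have hq : (q : 𝕜) ≠ 0 := q.ne_zero
  refine unopMap_mul_eq_one (AlgHom.id 𝕜 (GLq q)) (antipode q) (adjoin_T_θ q) ?_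
  rintro _ (rfl | ⟨⟨i, j⟩, rfl⟩)
  · simp [comul_θ, counit_θ, unop_antipode_θ, det_mul_θ]
  · have h : ∑ k, adj q i k * Mq.T q k j = if i = j then Mq.det q else 0 := by
      fin_cases i <;> fin_cases j <;>
        simp [adj, Mq.det, Mq.da, Mq.db, Mq.ca, Mq.cb, smul_smul, hq, sub_smul] <;> abel
    have h'' : (toConv (unopMap (antipode q)) * toConv (AlgHom.id 𝕜 (GLq q)).toLinearMap)
        (ofMq q (Mq.T q i j)) = θ q * ofMq q (∑ k, adj q i k * Mq.T q k j) := by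
      simp only [LinearMap.convMul_apply, comul_T, map_sum, TensorProduct.map_tmul,
        LinearMap.mul'_apply]
      simp [unop_antipode_T, mul_add, mul_assoc]
    rw [h'', h, counit_ofMq, Mq.counit_T]
    split_ifs <;> simp [θ_mul_det]

end GLq

/-! ### The two-dimensional representation and its braiding. -/

namespace Mq

variable {𝕜 : Type*} [Field 𝕜] (q s : 𝕜ˣ)

/-- The matrices with entries `R (T j i ⊗ T k l)`. -/
noncomputable def rVal : Fin 2 → Fin 2 → Matrix (Fin 2) (Fin 2) 𝕜 :=
  ![![(s : 𝕜)⁻¹ • !![(q : 𝕜), 0; 0, 1], 0],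
    ![(s : 𝕜)⁻¹ • !![0, 0; (q : 𝕜) - (q : 𝕜)⁻¹, 0], (s : 𝕜)⁻¹ • !![1, 0; 0, (q : 𝕜)]]]

/-- The representation `c ↦ (R (T j i ⊗ c))` of `M_q(2)`. -/
noncomputable def rep : Mq q →ₐ[𝕜] Matrix (Fin 2) (Fin 2) 𝕜 :=
  lift q (rVal q s) (by
    intro x y h
    cases h <;>
    · simp only [map_mul, map_smul, map_sub, FreeAlgebra.lift_ι_apply]
      ext i j
      fin_cases i <;> fin_cases j <;>
        simp [rVal, Matrix.mul_apply, Fin.sum_univ_two] <;> ring)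

theorem rep_T (i j : Fin 2) : rep q s (T q i j) = rVal q s i j := lift_T q _ _ i j

variable {q s}

/-- The determinant acts by the scalar `q s⁻²`; this is where the square-root normalisation matters.
-/
theorem rep_det (hs : s ^ 2 = q) : rep q s (det q) = 1 := by
  have hs' : (s : 𝕜)⁻¹ * ((s : 𝕜)⁻¹ * q) = 1 := by
    have : (s : 𝕜) ≠ 0 := s.ne_zero
    rw [← hs]; push_cast; field_simp
  rw [det, map_sub, map_smul, map_mul, map_mul]
  simp only [rep_T]
  ext i j
  fin_cases i <;> fin_cases j <;>
    simp [rVal] <;> linear_combination hs'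

end Mq

namespace GLq

variable {𝕜 : Type*} [Field 𝕜] {q s : 𝕜ˣ} (hs : s ^ 2 = q)

/-- The representation `c ↦ (R (T j i ⊗ c))` of `GL_q(2)`. -/
noncomputable def rep : GLq q →ₐ[𝕜] Matrix (Fin 2) (Fin 2) 𝕜 :=
  lift q (Mq.rep q s) 1 (fun _ ↦ Commute.one_right _) (by rw [Mq.rep_det hs, mul_one])

theorem rep_ofMq (x : Mq q) : rep hs (ofMq q x) = Mq.rep q s x := lift_ofMq q _ _ _ _ x

theorem rep_θ : rep hs (θ q) = 1 := lift_θ q _ _ _ _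

/-- The functional `R (T i j ⊗ ·)`. -/
noncomputable def coord (i j : Fin 2) : WithConv (GLq q →ₗ[𝕜] 𝕜) :=
  toConv (Matrix.entryLinearMap 𝕜 𝕜 j i ∘ₗ (rep hs).toLinearMap)

@[simp]
theorem coord_apply (i j : Fin 2) (x : GLq q) : coord hs i j x = rep hs x j i := rfl

/-- The tensor square of the representation `rep`. -/
noncomputable def repSq : GLq q →ₐ[𝕜] Matrix (Fin 2 × Fin 2) (Fin 2 × Fin 2) 𝕜 :=
  (Matrix.kroneckerAlgEquiv (Fin 2) (Fin 2) 𝕜).toAlgHom.comp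
    ((Algebra.TensorProduct.map (rep hs) (rep hs)).comp (Bialgebra.comulAlgHom 𝕜 (GLq q)))

theorem repSq_apply (x : GLq q) (i j k l : Fin 2) :
    repSq hs x (i, k) (j, l) = (coord hs j i * coord hs l k) x := by
  rw [(ℛ 𝕜 x).convMul_apply]
  simp [repSq, ← (ℛ 𝕜 x).eq, Matrix.sum_apply]

variable (q) in
/-- The braiding of the two-dimensional corepresentation, up to scale. -/
noncomputable def braiding : Matrix (Fin 2 × Fin 2) (Fin 2 × Fin 2) 𝕜 :=
  Matrix.of fun x y ↦
    if x = y then (if x.1 = x.2 then (q : 𝕜) else if x.1 = 1 then (q : 𝕜) - (q : 𝕜)⁻¹ else 0)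
    else if x = y.swap then 1 else 0

/-- On the matrix generators this is a finite check of scalars which amounts to the Yang–Baxter
equation; `θ` acts as the identity. -/
theorem braiding_mul_repSq (x : GLq q) : braiding q * repSq hs x = repSq hs x * braiding q := by
  refine intertwine_of_adjoin _ _ _ (adjoin_T_θ q) ?_ x
  have hq : (q : 𝕜) ≠ 0 := q.ne_zero
  rintro _ (rfl | ⟨⟨k, l⟩, rfl⟩)
  · have h : repSq hs (θ q) = 1 := by
      simp [repSq, comul_θ, rep_θ]
    rw [h, mul_one, one_mul]
  · have h : repSq hs (ofMq q (Mq.T q k l)) =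
        ∑ m, Matrix.kronecker (Mq.rVal q s k m) (Mq.rVal q s m l) := by
      simp [repSq, comul_T, rep_ofMq, Mq.rep_T]
    simp only [h]
    ext ⟨a, b⟩ ⟨c, d⟩
    simp only [Matrix.mul_apply, Fintype.sum_prod_type, Fin.sum_univ_two, Matrix.add_apply]
    fin_cases k <;> fin_cases l <;> fin_cases a <;> fin_cases b <;> fin_cases c <;> fin_cases d <;>
      simp [braiding, Mq.rVal] <;> (try field_simp) <;> (try ring)

end GLq

/-! ### The self-pairing of `GL_q(2)`. -/

namespace GLq

variable {𝕜 : Type*} [Field 𝕜] {q s : 𝕜ˣ} (hs : s ^ 2 = q)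

theorem braiding_mul_coord (x : GLq q) (i j k l : Fin 2) :
    ∑ a, ∑ b, braiding q (i, k) (a, b) * (coord hs j a * coord hs l b) x =
      ∑ a, ∑ b, (coord hs a i * coord hs b k) x * braiding q (a, b) (j, l) := by
  simpa only [Matrix.mul_apply, Fintype.sum_prod_type, repSq_apply] using
    congrFun (congrFun (braiding_mul_repSq hs x) (i, k)) (j, l)

/-- The Manin relations are entries of the commutation of `braiding` with the tensor square of
`rep`. The index quadruples below select those entries. -/
theorem coord_rel (x y : FreeAlgebra 𝕜 (Fin 2 × Fin 2)) (h : ManinRel q x y) :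
    FreeAlgebra.lift 𝕜 (fun p : Fin 2 × Fin 2 ↦ coord hs p.1 p.2) x =
      FreeAlgebra.lift 𝕜 (fun p : Fin 2 × Fin 2 ↦ coord hs p.1 p.2) y := by
  have key := braiding_mul_coord hs
  simp only [Fin.sum_univ_two] at key
  cases h <;>
  simp only [map_mul, map_smul, map_sub, FreeAlgebra.lift_ι_apply] <;>
  refine WithConv.ext (LinearMap.ext fun x ↦ ?_)
  · have h := key x 0 0 1 0
    simp [braiding, -LinearMap.convMul_apply] at h ⊢
    linear_combination h
  · have h := key x 0 0 0 1
    simp [braiding, -LinearMap.convMul_apply] at h ⊢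
    linear_combination -h
  · have h := key x 1 0 1 1
    simp [braiding, -LinearMap.convMul_apply] at h ⊢
    linear_combination -h
  · have h := key x 0 1 1 1
    simp [braiding, -LinearMap.convMul_apply] at h ⊢
    linear_combination h
  · have h := key x 0 0 1 1
    simp [braiding, -LinearMap.convMul_apply] at h ⊢
    linear_combination -h
  -- This entry gives the relation with `γβ` in place of `βγ`; the second entry exchanges the two
  -- factors.
  · have h := key x 0 1 1 0
    have h' := key x 0 0 1 1
    simp [braiding, -LinearMap.convMul_apply] at h h' ⊢
    linear_combination -h - ((q : 𝕜)⁻¹ - q) * h'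

/-- The algebra map `ξ ↦ R (ξ ⊗ ·)` on `M_q(2)`. -/
noncomputable def pairingMq : Mq q →ₐ[𝕜] WithConv (GLq q →ₗ[𝕜] 𝕜) :=
  Mq.lift q (coord hs) (coord_rel hs)

theorem pairingMq_T (i j : Fin 2) : pairingMq hs (Mq.T q i j) = coord hs i j :=
  Mq.lift_T q _ _ i j

theorem coord_mul (i j : Fin 2) (b c : GLq q) :
    coord hs i j (b * c) = ∑ k, coord hs i k c * coord hs k j b := by
  simp only [coord_apply, map_mul, Matrix.mul_apply]
  exact Finset.sum_congr rfl fun k _ ↦ mul_comm _ _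

/-- The standard coalgebra representation of a generator. -/
noncomputable def reprT (i j : Fin 2) : Coalgebra.Repr 𝕜 (Mq.T q i j) (Fin 2) where
  index := Finset.univ
  left k := Mq.T q i k
  right k := Mq.T q k j
  eq := (Mq.comul_T q i j).symm

/-- The standard coalgebra representation of a generator of `GL_q(2)`. -/
noncomputable def reprOfMqT (i j : Fin 2) : Coalgebra.Repr 𝕜 (ofMq q (Mq.T q i j)) (Fin 2) where
  index := Finset.univ
  left k := ofMq q (Mq.T q i k)
  right k := ofMq q (Mq.T q k j)
  eq := (comul_T q i j).symm

theorem onMul_pairingMq : onMul (pairingMq hs) = splitMul (pairingMq hs) := by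
  refine Mq.algHom_ext q fun i j ↦ WithConv.ext (TensorProduct.ext' fun b c ↦ ?_)
  rw [onMul_apply, splitMul_apply _ (reprT i j), pairingMq_T, coord_mul]
  simp only [reprT, pairingMq_T]

/-- The determinant is grouplike, so `onMul_pairingMq` makes its functional a character of
`GL_q(2)`. It then only has to be compared with the counit on the matrix generators. -/
theorem pairingMq_det : pairingMq hs (Mq.det q) = 1 := by
  have hs' : (s : 𝕜)⁻¹ * ((s : 𝕜)⁻¹ * q) = 1 := by
    have : (s : 𝕜) ≠ 0 := s.ne_zero
    rw [← hs]; push_cast; field_simp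
  have hdet : pairingMq hs (Mq.det q) =
      coord hs 0 0 * coord hs 1 1 - (q : 𝕜)⁻¹ • (coord hs 0 1 * coord hs 1 0) := by
    rw [Mq.det, map_sub, map_smul, map_mul, map_mul]
    simp only [pairingMq_T]
  let rdet : Coalgebra.Repr 𝕜 (Mq.det q) Unit :=
    { index := Finset.univ, left := fun _ ↦ Mq.det q, right := fun _ ↦ Mq.det q
      eq := by simp [Mq.comul_det] }
  have hmul (b c : GLq q) : pairingMq hs (Mq.det q) (b * c) =
      pairingMq hs (Mq.det q) b * pairingMq hs (Mq.det q) c := by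
    rw [← onMul_apply, onMul_pairingMq, splitMul_apply _ rdet]
    simp [rdet, mul_comm]
  have hone : pairingMq hs (Mq.det q) 1 = 1 := by
    rw [hdet]
    simp [Algebra.TensorProduct.one_def]
  have h : AlgHom.ofLinearMap (pairingMq hs (Mq.det q)).ofConv hone hmul =
      Bialgebra.counitAlgHom 𝕜 (GLq q) := by
    refine algHom_ext_ofMq q fun i j ↦ ?_
    change pairingMq hs (Mq.det q) (ofMq q (Mq.T q i j)) = counit (R := 𝕜) (ofMq q (Mq.T q i j))
    rw [hdet, counit_ofMq, Mq.counit_T]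
    simp only [ofConv_sub, ofConv_smul, LinearMap.sub_apply, LinearMap.smul_apply,
      (reprOfMqT i j).convMul_apply, coord_apply]
    fin_cases i <;> fin_cases j <;>
      simp [reprOfMqT, rep_ofMq, Mq.rep_T, Mq.rVal] <;> linear_combination hs'
  ext x
  exact DFunLike.congr_fun h x

/-- The algebra map `ξ ↦ R (ξ ⊗ ·)` on `GL_q(2)`. -/
noncomputable def pairing : GLq q →ₐ[𝕜] WithConv (GLq q →ₗ[𝕜] 𝕜) :=
  lift q (pairingMq hs) 1 (fun _ ↦ Commute.one_right _) (by rw [pairingMq_det, mul_one])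

theorem pairing_T (i j : Fin 2) : pairing hs (ofMq q (Mq.T q i j)) = coord hs i j :=
  (lift_ofMq q _ _ _ _ _).trans (pairingMq_T hs i j)

theorem pairing_θ : pairing hs (θ q) = 1 := lift_θ q _ _ _ _

theorem onMul_pairing : onMul (pairing hs) = splitMul (pairing hs) := by
  refine algHom_ext_ofMq q fun i j ↦ WithConv.ext (TensorProduct.ext' fun b c ↦ ?_)
  rw [onMul_apply, splitMul_apply _ (reprOfMqT i j), pairing_T, coord_mul]
  simp only [reprOfMqT, pairing_T]

/-- The standard R-form of `GL_q(2)`. -/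
noncomputable def rForm : ConvUnits 𝕜 (GLq q) :=
  formUnit (pairing hs) (unopMap (antipode q)) (id_mul_antipode q) (antipode_mul_id q)

theorem rForm_val : (rForm hs).val = toConv (form (pairing hs).toLinearMap) := rfl

end GLq

/-! ### Exchange relations and the R-form on `GL_q(2)`. -/

section Exchange

variable {𝕜 : Type*} [Field 𝕜] {q s : 𝕜ˣ} {K : Type*} [Ring K] [Bialgebra 𝕜 K]

/-- The exchange relation between the matrix of generators and an element `b` holds in any bialgebra
that receives `M_q(2)` as soon as it holds for generators `b`. -/
theorem transpose_mul_matLeft (ι : Mq q →ₐ[𝕜] K)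
    (hι : ∀ i j, comul (R := 𝕜) (ι (Mq.T q i j)) = ∑ k, ι (Mq.T q i k) ⊗ₜ[𝕜] ι (Mq.T q k j))
    (r : K →ₐ[𝕜] Matrix (Fin 2) (Fin 2) 𝕜) (hr : ∀ i j, r (ι (Mq.T q i j)) = Mq.rVal q s i j)
    (i j : Fin 2) :
    (Matrix.of fun i j ↦ ι (Mq.T q i j)).transpose * matLeft r (ι (Mq.T q i j)) =
      matRight r (ι (Mq.T q i j)) * (Matrix.of fun i j ↦ ι (Mq.T q i j)).transpose := by
  have hq : (q : 𝕜) ≠ 0 := q.ne_zero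
  let R : Coalgebra.Repr 𝕜 (ι (Mq.T q i j)) (Fin 2) :=
    { index := Finset.univ, left := fun k ↦ ι (Mq.T q i k), right := fun k ↦ ι (Mq.T q k j)
      eq := (hι i j).symm }
  ext a b
  simp only [Matrix.mul_apply, Matrix.transpose_apply, matLeft_apply r R, matRight_apply r R,
    Matrix.of_apply, R, hr, Fin.sum_univ_two, ← map_smul, ← map_add, ← map_mul]
  -- Both sides are images under `ι`, so the relation is checked within `M_q(2)`.
  congr 1
  fin_cases i <;> fin_cases j <;> fin_cases a <;> fin_cases b <;>
    simp [Mq.rVal, Mq.ba, Mq.ca, Mq.db, Mq.dc, Mq.cb, Mq.da, smul_smul] <;>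
    match_scalars <;> field_simp <;> ring

end Exchange

namespace GLq

variable {𝕜 : Type*} [Field 𝕜] {q s : 𝕜ˣ} (hs : s ^ 2 = q)

theorem exchange_rep (b : GLq q) :
    (Matrix.of fun i j ↦ ofMq q (Mq.T q i j)).transpose * matLeft (rep hs) b =
      matRight (rep hs) b * (Matrix.of fun i j ↦ ofMq q (Mq.T q i j)).transpose := by
  refine intertwine_of_adjoin _ _ _ (adjoin_T_θ q) ?_ b
  rintro _ (rfl | ⟨⟨i, j⟩, rfl⟩)
  · have hl : matLeft (rep hs) (θ q) = (Algebra.ofId 𝕜 (GLq q)).mapMatrix (rep hs (θ q)) *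
        Matrix.scalarAlgHom (Fin 2) 𝕜 (θ q) := comulLift_grouplike _ _ _ (comul_θ q)
    have hr : matRight (rep hs) (θ q) = Matrix.scalarAlgHom (Fin 2) 𝕜 (θ q) *
        (Algebra.ofId 𝕜 (GLq q)).mapMatrix (rep hs (θ q)) := comulLift_grouplike _ _ _ (comul_θ q)
    rw [hl, hr, rep_θ, map_one, one_mul, mul_one]
    ext i j
    simpa using (commute_θ q (ofMq q (Mq.T q j i))).eq
  · exact transpose_mul_matLeft (ofMq q) (comul_T q) (rep hs)
      (fun i j ↦ (rep_ofMq hs _).trans (Mq.rep_T q s i j)) i j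

theorem actLeft_pairing (a : GLq q) :
    actLeft (pairing hs) a * toConv LinearMap.id =
      toConv LinearMap.id * actRight (pairing hs) a := by
  refine (intertwine_of_adjoin (actRight (pairing hs)) (actLeft (pairing hs)) _ (adjoin_T_θ q)
    ?_ a).symm
  rintro _ (rfl | ⟨⟨i, j⟩, rfl⟩)
  · exact (actLeft_mul_id_of_grouplike (comul_θ q) (pairing_θ hs) (commute_θ q)).symm
  · exact (actLeft_mul_id_of_matrix (t := Matrix.of fun i j ↦ ofMq q (Mq.T q i j)) (comul_T q)
      (fun i j b ↦ by rw [Matrix.of_apply, pairing_T, coord_apply]) (exchange_rep hs) i j).symm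

theorem isCoquasitriangular_rForm : IsCoquasitriangular (rForm hs) where
  mul_comm := mul_comm_of_actLeft (actLeft_pairing hs)
  mul_right := (formMulRight_eq_iff _).2 (rightConv_form_mul (onMul_pairing hs))
  mul_left := (formMulLeft_eq_iff _).2 (map_mul (pairing hs))

/-- A universal R-form on `GL_q(2)` is determined by its restriction to `M_q(2)`. -/
theorem IsExtendedRForm.ext {R : ConvUnits 𝕜 (Mq q)} {S S' : ConvUnits 𝕜 (GLq q)}
    (h : IsExtendedRForm q R S) (h' : IsExtendedRForm q R S') : S = S' := by
  let p : (WithConv (GLq q →ₗ[𝕜] 𝕜))ᵐᵒᵖ →ₐ[𝕜] (WithConv (Mq q →ₗ[𝕜] 𝕜))ᵐᵒᵖ :=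
    AlgHom.op (precomp 𝕜 (ofMqBialgHom q).toCoalgHom)
  -- With the left argument kept in `M_q(2)`, the anti-homomorphisms in the right argument agree on
  -- `M_q(2)`, hence on `GL_q(2)`. The left argument is extended afterwards in `hl`.
  have hr : p.comp (rightHom h.coquasitriangular) = p.comp (rightHom h'.coquasitriangular) := by
    refine algHom_ext_ofMq q fun i j ↦ MulOpposite.unop_injective ?_
    refine WithConv.ext (LinearMap.ext fun a ↦ ?_)
    exact (h.extends_form a _).trans (h'.extends_form a _).symm
  have hl : leftHom h.coquasitriangular = leftHom h'.coquasitriangular := by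
    refine algHom_ext_ofMq q fun i j ↦ WithConv.ext (LinearMap.ext fun b ↦ ?_)
    exact congrArg (fun f : (WithConv (Mq q →ₗ[𝕜] 𝕜))ᵐᵒᵖ ↦ f.unop (Mq.T q i j))
      (DFunLike.congr_fun hr b)
  refine Units.ext (WithConv.ext (TensorProduct.ext' fun a b ↦ ?_))
  exact congrArg (fun f : WithConv (GLq q →ₗ[𝕜] 𝕜) ↦ f b) (DFunLike.congr_fun hl a)

end GLq

/-! ### The R-form on `M_q(2)`: uniqueness and existence by restriction. -/

namespace Mq

variable {𝕜 : Type*} [Field 𝕜] {q s : 𝕜ˣ}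

theorem hasStandardValues_iff (R : Mq q ⊗[𝕜] Mq q →ₗ[𝕜] 𝕜) : HasStandardValues q s R ↔
    ∀ i j k l, R (T q i j ⊗ₜ T q k l) = rVal q s k l j i := by
  constructor
  · intro h
    have key (a b : Fin 4) := congrFun (congrFun h a) b
    have h00 := key 0 0
    have h01 := key 0 1
    have h02 := key 0 2
    have h03 := key 0 3
    have h10 := key 1 0
    have h11 := key 1 1
    have h12 := key 1 2
    have h13 := key 1 3
    have h20 := key 2 0
    have h21 := key 2 1
    have h22 := key 2 2
    have h23 := key 2 3
    have h30 := key 3 0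
    have h31 := key 3 1
    have h32 := key 3 2
    have h33 := key 3 3
    simp at h00 h01 h02 h03 h10 h11 h12 h13 h20 h21 h22 h23 h30 h31 h32 h33
    intro i j k l
    fin_cases i <;> fin_cases j <;> fin_cases k <;> fin_cases l <;> simp [rVal, *]
  · intro h
    ext a b
    fin_cases a <;> fin_cases b <;> simp [h, rVal]

variable (q) in
/-- Evaluation of functionals on the matrix of generators. -/
noncomputable def evalT : WithConv (Mq q →ₗ[𝕜] 𝕜) →ₐ[𝕜] Matrix (Fin 2) (Fin 2) 𝕜 :=
  AlgHom.ofLinearMap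
    { toFun := fun f ↦ Matrix.of fun i j ↦ f (T q i j)
      map_add' := fun _ _ ↦ rfl
      map_smul' := fun _ _ ↦ rfl }
    (by ext i j; exact (counit_T q i j).trans Matrix.one_apply.symm)
    (fun f g ↦ by
      ext i j
      change (f * g) (T q i j) = _
      rw [(GLq.reprT i j).convMul_apply]
      rfl)

/-- A universal R-form on `M_q(2)` is determined by its values on the generators. -/
theorem IsStandardRForm.ext {R R' : ConvUnits 𝕜 (Mq q)} (h : IsStandardRForm q s R)
    (h' : IsStandardRForm q s R') : R = R' := by
  -- Evaluating functionals on the matrix of generators is multiplicative because the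
  -- comultiplication is that of matrices. The left argument can thus be held at generators while
  -- the right one becomes arbitrary.
  have hr : (AlgHom.op (evalT q)).comp (rightHom h.coquasitriangular) =
      (AlgHom.op (evalT q)).comp (rightHom h'.coquasitriangular) := by
    refine algHom_ext q fun k l ↦ MulOpposite.unop_injective ?_
    ext i j
    exact ((hasStandardValues_iff _).1 h.values i j k l).trans
      ((hasStandardValues_iff _).1 h'.values i j k l).symm
  have hl : leftHom h.coquasitriangular = leftHom h'.coquasitriangular := by
    refine algHom_ext q fun i j ↦ WithConv.ext (LinearMap.ext fun b ↦ ?_)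
    exact congrArg (fun M : (Matrix (Fin 2) (Fin 2) 𝕜)ᵐᵒᵖ ↦ M.unop i j) (DFunLike.congr_fun hr b)
  refine Units.ext (WithConv.ext (TensorProduct.ext' fun a b ↦ ?_))
  exact congrArg (fun f : WithConv (Mq q →ₗ[𝕜] 𝕜) ↦ f b) (DFunLike.congr_fun hl a)

variable (hs : s ^ 2 = q)

/-- The algebra map `ξ ↦ R (ξ ⊗ ·)` on `M_q(2)`. -/
noncomputable def pairing : Mq q →ₐ[𝕜] WithConv (Mq q →ₗ[𝕜] 𝕜) :=
  (precomp 𝕜 (GLq.ofMqBialgHom q).toCoalgHom).comp (GLq.pairingMq hs)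

theorem pairing_T_apply (i j : Fin 2) (b : Mq q) : pairing hs (T q i j) b = rep q s b j i := by
  change GLq.pairingMq hs (T q i j) (GLq.ofMq q b) = _
  rw [GLq.pairingMq_T, GLq.coord_apply, GLq.rep_ofMq]

/-- The standard R-form of `M_q(2)`. -/
noncomputable def rForm : ConvUnits 𝕜 (Mq q) :=
  -- Invertibility is inherited from `GL_q(2)`, since restriction along a bialgebra map is a
  -- homomorphism of convolution algebras.
  Units.map (precomp 𝕜 (Bialgebra.TensorProduct.map (GLq.ofMqBialgHom q)
    (GLq.ofMqBialgHom q)).toCoalgHom) (GLq.rForm hs)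

theorem rForm_tmul (ξ η : Mq q) :
    (rForm hs).val (ξ ⊗ₜ η) = (GLq.rForm hs).val (GLq.ofMq q ξ ⊗ₜ GLq.ofMq q η) := rfl

theorem rForm_val : (rForm hs).val = toConv (form (pairing hs).toLinearMap) := by
  refine WithConv.ext (TensorProduct.ext' fun a b ↦ ?_)
  rw [rForm_tmul, GLq.rForm_val]
  exact congrArg (fun f : WithConv (GLq q →ₗ[𝕜] 𝕜) ↦ f (GLq.ofMq q b))
    (GLq.lift_ofMq q _ _ _ _ a)

theorem onMul_pairing : onMul (pairing hs) = splitMul (pairing hs) := by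
  refine algHom_ext q fun i j ↦ WithConv.ext (TensorProduct.ext' fun b c ↦ ?_)
  rw [onMul_apply, splitMul_apply _ (GLq.reprT i j), pairing_T_apply, map_mul, Matrix.mul_apply]
  simp only [GLq.reprT, pairing_T_apply]
  exact Finset.sum_congr rfl fun k _ ↦ mul_comm _ _

theorem exchange_rep (b : Mq q) :
    (Matrix.of fun i j ↦ T q i j).transpose * matLeft (rep q s) b =
      matRight (rep q s) b * (Matrix.of fun i j ↦ T q i j).transpose := by
  refine intertwine_of_adjoin _ _ _ (adjoin_T q) ?_ b
  rintro _ ⟨⟨i, j⟩, rfl⟩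
  exact transpose_mul_matLeft (AlgHom.id 𝕜 _) (comul_T q) (rep q s) (rep_T q s) i j

theorem actLeft_pairing (a : Mq q) :
    actLeft (pairing hs) a * toConv LinearMap.id =
      toConv LinearMap.id * actRight (pairing hs) a := by
  refine (intertwine_of_adjoin (actRight (pairing hs)) (actLeft (pairing hs)) _ (adjoin_T q)
    ?_ a).symm
  rintro _ ⟨⟨i, j⟩, rfl⟩
  exact (actLeft_mul_id_of_matrix (t := Matrix.of fun i j ↦ T q i j) (comul_T q)
    (pairing_T_apply hs) exchange_rep i j).symm

theorem isCoquasitriangular_rForm : IsCoquasitriangular (rForm hs) where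
  mul_comm := by
    rw [rForm_val]
    exact mul_comm_of_actLeft (actLeft_pairing hs)
  mul_right := by
    rw [rForm_val]
    exact (formMulRight_eq_iff _).2 (rightConv_form_mul (onMul_pairing hs))
  mul_left := by
    rw [rForm_val]
    exact (formMulLeft_eq_iff _).2 (map_mul (pairing hs))

theorem isStandardRForm_rForm : IsStandardRForm q s (rForm hs) where
  coquasitriangular := isCoquasitriangular_rForm hs
  values := by
    rw [hasStandardValues_iff, rForm_val]
    intro i j k l
    rw [← rep_T]
    exact pairing_T_apply hs i j _

end Mq

theorem GLq.isExtendedRForm_rForm {𝕜 : Type*} [Field 𝕜] {q s : 𝕜ˣ} (hs : s ^ 2 = q) :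
    GLq.IsExtendedRForm q (Mq.rForm hs) (GLq.rForm hs) where
  coquasitriangular := GLq.isCoquasitriangular_rForm hs
  extends_form _ _ := rfl

theorem mainTheorem11 {𝕜 : Type*} [Field 𝕜] (q s : 𝕜ˣ) (hs : s ^ 2 = q) :
    ∃ R : ConvUnits 𝕜 (Mq q),
      (Mq.IsStandardRForm q s R ∧ ∀ R' : ConvUnits 𝕜 (Mq q), Mq.IsStandardRForm q s R' → R' = R) ∧
      (tensorForm (Mq.der q) (Mq.der q) ≠ 0 ∧
        IsInfinitesimalRForm R (tensorForm (Mq.der q) (Mq.der q)) ∧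
        IsCartier R (tensorForm (Mq.der q) (Mq.der q)) ∧
        ∀ (m n : ℕ), ∀ ξ ∈ Mq.homogeneous q m, ∀ η ∈ Mq.homogeneous q n,
          tensorForm (Mq.der q) (Mq.der q) (ξ ⊗ₜ[𝕜] η) =
            (m : 𝕜) * (n : 𝕜) * counit (R := 𝕜) (ξ * η)) ∧
      ∃ S : ConvUnits 𝕜 (GLq q),
        (GLq.IsExtendedRForm q R S ∧
          ∀ S' : ConvUnits 𝕜 (GLq q), GLq.IsExtendedRForm q R S' → S' = S) ∧
        ∃ D : Polynomial (Mq q) →ₗ[𝕜] 𝕜,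
          (GLq.IsHatDer q D ∧ ∀ D' : Polynomial (Mq q) →ₗ[𝕜] 𝕜, GLq.IsHatDer q D' → D' = D) ∧
          ∃ E : GLq q →ₗ[𝕜] 𝕜,
            E ∘ₗ (GLq.mk q).toLinearMap = D ∧
            IsPointDerivation (Bialgebra.counitAlgHom 𝕜 (GLq q)) E ∧
            tensorForm E E ≠ 0 ∧
            IsInfinitesimalRForm S (tensorForm E E) ∧
            IsCartier S (tensorForm E E) := by
  have hM : IsCartier (Mq.rForm hs) (tensorForm (Mq.der q) (Mq.der q)) :=
    isCartier_tensorForm (Mq.isCoquasitriangular_rForm hs) (Mq.der_isPointDerivation q)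
      (Mq.isCentral_der q)
  have hG : IsCartier (GLq.rForm hs) (tensorForm (GLq.der q) (GLq.der q)) :=
    isCartier_tensorForm (GLq.isCoquasitriangular_rForm hs) (GLq.der_isPointDerivation q)
      (GLq.isCentral_der q)
  exact ⟨Mq.rForm hs,
    ⟨Mq.isStandardRForm_rForm hs, fun _ h ↦ h.ext (Mq.isStandardRForm_rForm hs)⟩,
    ⟨Mq.tensorForm_der_ne_zero q, hM.infinitesimalRForm, hM,
      fun _ _ _ hξ _ hη ↦ Mq.tensorForm_der_homogeneous q hξ hη⟩,
    GLq.rForm hs,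
    ⟨GLq.isExtendedRForm_rForm hs, fun _ h ↦ h.ext (GLq.isExtendedRForm_rForm hs)⟩,
    _, ⟨GLq.isHatDer_der q, fun _ h ↦ h.ext (GLq.isHatDer_der q)⟩,
    GLq.der q, rfl, GLq.der_isPointDerivation q, GLq.tensorForm_der_ne_zero q,
    hG.infinitesimalRForm, hG⟩
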